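/- Let $M$ be a smooth manifold and $\pi:A\to M$ a smooth real vector bundle of finite rank, with dual bundle $\pi^*:A^*\to M$. For $\mu\in\Gamma(A)$ let $\tilde\mu\in C^\infty(A^*)$ be the linear function $\tilde\mu(\alpha)=\alpha(\mu(\pi^*(\alpha)))$. A Jacobi structure on a manifold $N$ is a pair $(\Lambda,E)$ of a smooth $2$-vector field and a smooth vector field with $[\Lambda,\Lambda]_{SN}=2E\wedge\Lambda$ and $[E,\Lambda]_{SN}=0$, where $[\,,]_{SN}$ is the Schouten–Nijenhuis bracket, with the sign convention $[\Lambda,\Lambda]_{SN}(df,dg,dh)=2\sum_{\mathrm{cycl}}\Lambda(d(\Lambda(df,dg)),dh)$; its Jacobi bracket is $\{f,g\}=\Lambda(df,dg)+fE(g)-gE(f)$. The wedge product of vector fields is normalized by $(X\wedge Y)(\alpha,\beta)=\alpha(X)\beta(Y)-\alpha(Y)\beta(X)$, and $(E\wedge\Lambda)(\alpha,\beta,\gamma)=\alpha(E)\Lambda(\beta,\gamma)+\beta(E)\Lambda(\gamma,\alpha)+\gamma(E)\Lambda(\alpha,\beta)$. A Lie algebroid structure on $A$ is a pair $([\![\,,]\!],\rho)$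 of a real Lie algebra bracket on $\Gamma(A)$ and a vector bundle map $\rho:A\to TM$ over the identity such that $\rho[\![\mu,\eta]\!]=[\rho(\mu),\rho(\eta)]$ and $[\![\mu,f\eta]\!]=f[\![\mu,\eta]\!]+(\rho(\mu)f)\eta$ for all $\mu,\eta\in\Gamma(A)$, $f\in C^\infty(M)$. A section $\phi\in\Gamma(A^*)$ is a $1$-cocycle if $\phi[\![\mu,\eta]\!]=\rho(\mu)(\phi(\eta))-\rho(\eta)(\phi(\mu))$ for all $\mu,\eta\in\Gamma(A)$. Let $(A,[\![\,,]\!],\rho)$ be a Lie algebroid over $M$ and $\phi\in\Gamma(A^*)$ a $1$-cocycle. Then there is a unique Jacobi structure $(\Lambda_{(A^*,\phi)},E_{(A^*,\phi)})$ on the manifold $A^*$ whose Jacobi bracket satisfies $$\{\tilde\mu,\tilde\eta\}=\widetilde{[\![\mu,\eta]\!]},\qquad \{\tilde\mu,f\circ\pi^*\}=(\rho(\mu)(f)+\phi(\mu)f)\circ\pi^*,\qquad \{f\circ\pi^*,g\circ\pi^*\}=0$$ for all $\mu,\eta\in\Gamma(A)$ and $f,g\in C^\infty(M)$. It is given by $$\Lambda_{(A^*,\phi)}=\Lambda_{A^*}+\Delta\wedge\phi^v,\qquad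 E_{(A^*,\phi)}=-\phi^v.$$ Here $\Delta$ is the Liouville (Euler) vector field of $A^*$, $\phi^v$ is the vertical lift of $\phi$, and $\Lambda_{A^*}$ is the linear Poisson structure of the Lie algebroid: for local coordinates $(x^l)$ on $M$, a local basis of sections $(e_i)$ of $A$ with $[\![e_i,e_j]\!]=\sum_k c_{ij}^k e_k$, $\rho(e_i)=\sum_l\rho_i^l\,\partial/\partial x^l$, and the fibred coordinates $(x^l,\mu_j=\tilde e_j)$ on $A^*$, $$\Lambda_{A^*}=\sum_{i<j}\sum_k c_{ij}^k\mu_k\frac{\partial}{\partial\mu_i}\wedge\frac{\partial}{\partial\mu_j}+\sum_{i,l}\rho_i^l\frac{\partial}{\partial\mu_i}\wedge\frac{\partial}{\partial x^l}.$$ -/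

import Mathlib

open Bundle Manifold
open scoped ContDiff Topology

set_option maxSynthPendingDepth 3

noncomputable section

/-! ### Multivector fields and Jacobi structures on a manifold -/

section Jacobi

variable {E : Type*} [NormedAddCommGroup E] [NormedSpace ℝ E]
  {H : Type*} [TopologicalSpace H] (I : ModelWithCorners ℝ E H)
  {N : Type*} [TopologicalSpace N] [ChartedSpace H N]

/-- The cotangent space `T*_x N`. -/
abbrev Cotangent (x : N) : Type _ := TangentSpace I x →L[ℝ] ℝ

/-- Bilinear forms on the cotangent space `T*_x N`; the bivectors at `x`, i.e. the elements of
`⋀² T_x N`, are the alternating ones among them. -/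
abbrev CotangentForm (x : N) : Type _ := Cotangent I x →L[ℝ] Cotangent I x →L[ℝ] ℝ

/-- Evaluation of covectors at a tangent vector. -/
def evalVec {x : N} (X : TangentSpace I x) : Cotangent I x →L[ℝ] ℝ where
  toFun α := α X
  map_add' _ _ := rfl
  map_smul' _ _ := rfl
  cont := continuous_eval_const X

/-- The bivector `X ∧ Y` of two tangent vectors: `(X ∧ Y)(α, β) = α(X) β(Y) - α(Y) β(X)`. -/
def wedgeVec {x : N} (X Y : TangentSpace I x) : CotangentForm I x :=
  (evalVec I X).smulRight (evalVec I Y) - (evalVec I Y).smulRight (evalVec I X)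

/-- The trivector `X ∧ Λ` of a tangent vector and a bivector, as a function of three covectors:
`(X ∧ Λ)(α, β, γ) = α(X) Λ(β, γ) + β(X) Λ(γ, α) + γ(X) Λ(α, β)`. -/
def wedgeVecBivec {x : N} (X : TangentSpace I x) (Λ : CotangentForm I x)
    (α β γ : Cotangent I x) : ℝ :=
  α X * Λ β γ + β X * Λ γ α + γ X * Λ α β

/-- The function `Λ(df, dg)`. -/
def pairing (Λ : ∀ x : N, CotangentForm I x) (f g : N → ℝ) : N → ℝ :=
  fun x => Λ x (mvfderiv I f x) (mvfderiv I g x)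

/-- The derivative `X(f)` of a function along a vector field. -/
def along (X : ∀ x : N, TangentSpace I x) (f : N → ℝ) : N → ℝ :=
  fun x => mvfderiv I f x (X x)

/-- The Schouten-Nijenhuis bracket `[P, Q]` of two bivector fields, evaluated on `df, dg, dh`:
the sum over the cyclic permutations of `(f, g, h)` of
`P(d(Q(df, dg)), dh) + Q(d(P(df, dg)), dh)`. The sign is the one for which
`[X₁ ∧ X₂, Y₁ ∧ Y₂] = - ∑ i j, (-1)^(i+j) [X_i, Y_j] ∧ X_{3-i} ∧ Y_{3-j}`. -/
def schoutenBivec (P Q : ∀ x : N, CotangentForm I x) (f g h : N → ℝ) : N → ℝ :=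
  (pairing I P (pairing I Q f g) h + pairing I Q (pairing I P f g) h) +
  (pairing I P (pairing I Q g h) f + pairing I Q (pairing I P g h) f) +
  (pairing I P (pairing I Q h f) g + pairing I Q (pairing I P h f) g)

/-- The Schouten-Nijenhuis bracket `[X, Λ]` of a vector field and a bivector field, that is the
Lie derivative of `Λ` along `X`, evaluated on `df, dg`. -/
def schoutenVecBivec (X : ∀ x : N, TangentSpace I x) (Λ : ∀ x : N, CotangentForm I x)
    (f g : N → ℝ) : N → ℝ :=
  along I X (pairing I Λ f g) - pairing I Λ (along I X f) g - pairing I Λ f (along I X g)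

variable (N) in
/-- A Jacobi structure `(Λ, E)`: a smooth bivector field `Λ` and a smooth vector field `E` with
`[Λ, Λ] = 2 E ∧ Λ` and `[E, Λ] = 0`. The differentials of smooth functions span every cotangent
space, so the two identities between multivector fields are tested on them. -/
@[ext]
structure JacobiStructure [IsManifold I ∞ N] where
  /-- the bivector field -/
  bivec : ∀ x : N, CotangentForm I x
  /-- the vector field -/
  vec : ∀ x : N, TangentSpace I x
  bivec_self : ∀ (x : N) (α : Cotangent I x), bivec x α α = 0
  bivec_smooth : ContMDiff I (I.prod 𝓘(ℝ, (E →L[ℝ] ℝ) →L[ℝ] (E →L[ℝ] ℝ) →L[ℝ] ℝ)) ∞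
    (fun x => TotalSpace.mk' ((E →L[ℝ] ℝ) →L[ℝ] (E →L[ℝ] ℝ) →L[ℝ] ℝ)
      (E := fun x : N => CotangentForm I x) x (bivec x))
  vec_smooth : ContMDiff I I.tangent ∞ (fun x => (⟨x, vec x⟩ : TangentBundle I N))
  schouten_self : ∀ f g h : N → ℝ, ContMDiff I 𝓘(ℝ, ℝ) ∞ f → ContMDiff I 𝓘(ℝ, ℝ) ∞ g →
    ContMDiff I 𝓘(ℝ, ℝ) ∞ h → ∀ x : N,
      schoutenBivec I bivec bivec f g h x =
        2 * wedgeVecBivec I (vec x) (bivec x) (mvfderiv I f x) (mvfderiv I g x) (mvfderiv I h x)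
  schouten_vec : ∀ f g : N → ℝ, ContMDiff I 𝓘(ℝ, ℝ) ∞ f → ContMDiff I 𝓘(ℝ, ℝ) ∞ g →
    ∀ x : N, schoutenVecBivec I vec bivec f g x = 0

variable {I} in
/-- The Jacobi bracket `{f, g} = Λ(df, dg) + f E(g) - g E(f)`. -/
def JacobiStructure.bracket [IsManifold I ∞ N] (J : JacobiStructure I N) (f g : N → ℝ) : N → ℝ :=
  pairing I J.bivec f g + f * along I J.vec g - g * along I J.vec f

end Jacobi

/-! ### Lie algebroids -/

section Algebroid

variable {E : Type*} [NormedAddCommGroup E] [NormedSpace ℝ E]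
  {M : Type*} [TopologicalSpace M] [ChartedSpace E M]
  (F : Type*) [NormedAddCommGroup F] [NormedSpace ℝ F]
  (A : M → Type*) [∀ x, AddCommGroup (A x)] [∀ x, Module ℝ (A x)] [∀ x, TopologicalSpace (A x)]
  [TopologicalSpace (TotalSpace F A)] [FiberBundle F A] [VectorBundle ℝ F A]

variable (E) in
/-- The space `Γ(A)` of global smooth sections of `A`. -/
abbrev GlobalSections : Type _ := Cₛ^∞⟮𝓘(ℝ, E); F, A⟯

variable {F A} in
/-- The section `f μ`, for a smooth function `f` and a smooth section `μ`. -/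
def smulSection (f : C^∞⟮𝓘(ℝ, E), M; ℝ⟯) (μ : GlobalSections E F A) : GlobalSections E F A :=
  ⟨fun x => f x • μ x, f.contMDiff.smul_section μ.contMDiff⟩

variable (E) in
/-- A Lie algebroid structure on the vector bundle `A → M`: a real Lie algebra structure on `Γ(A)`
and a vector bundle map `ρ : A → TM` (the anchor) that is compatible with the Lie brackets and
satisfies the Leibniz rule. -/
structure LieAlgebroid [IsManifold 𝓘(ℝ, E) ∞ M] where
  /-- the Lie bracket on `Γ(A)` -/
  bracket : GlobalSections E F A →ₗ[ℝ] GlobalSections E F A →ₗ[ℝ] GlobalSections E F A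
  bracket_self : ∀ μ, bracket μ μ = 0
  jacobi : ∀ μ η ν,
    bracket μ (bracket η ν) + bracket η (bracket ν μ) + bracket ν (bracket μ η) = 0
  /-- the anchor map -/
  anchor : ∀ x : M, A x →ₗ[ℝ] TangentSpace 𝓘(ℝ, E) x
  anchor_smooth : ContMDiff (𝓘(ℝ, E).prod 𝓘(ℝ, F)) 𝓘(ℝ, E).tangent ∞
    (fun a : TotalSpace F A => (⟨a.1, anchor a.1 a.2⟩ : TangentBundle 𝓘(ℝ, E) M))
  anchor_bracket : ∀ (μ η : GlobalSections E F A) (x : M),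
    anchor x (bracket μ η x) = VectorField.mlieBracket 𝓘(ℝ, E)
      (fun y => anchor y (μ y)) (fun y => anchor y (η y)) x
  leibniz : ∀ (μ η : GlobalSections E F A) (f : C^∞⟮𝓘(ℝ, E), M; ℝ⟯) (x : M),
    bracket μ (smulSection f η) x =
      f x • bracket μ η x + mvfderiv 𝓘(ℝ, E) f x (anchor x (μ x)) • η x

/-! ### The dual bundle -/

/-- The fibre `A*_x` of the dual bundle. -/
abbrev DualFiber (x : M) : Type _ := A x →L[ℝ] ℝ

/-- The total space of the dual bundle `A* → M`, a manifold modelled on `E × F*`. -/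
abbrev DualBundle : Type _ := TotalSpace (F →L[ℝ] ℝ) (DualFiber A)

variable (E) in
/-- The model with corners of the total space of the dual bundle. -/
abbrev dualModel : ModelWithCorners ℝ (E × (F →L[ℝ] ℝ)) (ModelProd E (F →L[ℝ] ℝ)) :=
  𝓘(ℝ, E).prod 𝓘(ℝ, F →L[ℝ] ℝ)

variable (E) in
/-- The space `Γ(A*)` of global smooth sections of the dual bundle. -/
abbrev DualSections : Type _ := Cₛ^∞⟮𝓘(ℝ, E); F →L[ℝ] ℝ, DualFiber A⟯

variable {F A}

/-- `φ ∈ Γ(A*)` is a 1-cocycle: `φ[[μ, η]] = ρ(μ)(φ(η)) - ρ(η)(φ(μ))`. -/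
def LieAlgebroid.IsCocycle [IsManifold 𝓘(ℝ, E) ∞ M] (L : LieAlgebroid E F A)
    (φ : DualSections E F A) : Prop :=
  ∀ (μ η : GlobalSections E F A) (x : M),
    φ x (L.bracket μ η x) =
      mvfderiv 𝓘(ℝ, E) (fun y => φ y (η y)) x (L.anchor x (μ x)) -
        mvfderiv 𝓘(ℝ, E) (fun y => φ y (μ y)) x (L.anchor x (η x))

/-- The linear function `μ̃` on `A*` of a section `μ` of `A`. -/
def linearFunction (μ : GlobalSections E F A) : DualBundle F A → ℝ := fun p => p.2 (μ p.1)

variable (F A) in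
/-- The basic function `f ∘ π*` on `A*` of a function `f` on `M`. -/
def basicFunction (f : M → ℝ) : DualBundle F A → ℝ := fun p => f p.1

variable (E) in
/-- The vertical lift of `θ ∈ A*_x` to the point `p ∈ A*_x`: the velocity at `t = 0` of the curve
`t ↦ p + t θ`. -/
def verticalVec (p : DualBundle F A) (θ : DualFiber A p.1) : TangentSpace (dualModel E F) p :=
  mfderiv 𝓘(ℝ, ℝ) (dualModel E F)
    (fun t : ℝ => (⟨p.1, p.2 + t • θ⟩ : DualBundle F A)) 0 (1 : ℝ)

/-- The Liouville vector field `Δ` of `A*`. -/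
def liouville (p : DualBundle F A) : TangentSpace (dualModel E F) p := verticalVec E p p.2

/-- The vertical lift `φ^v` of a section `φ` of `A*`, a vector field on `A*`. -/
def verticalLift (φ : DualSections E F A) (p : DualBundle F A) : TangentSpace (dualModel E F) p :=
  verticalVec E p (φ p.1)

/-! ### The linear Poisson structure on the dual bundle of a Lie algebroid -/

section LinearPoisson

variable [FiniteDimensional ℝ E] [T2Space M] [IsManifold 𝓘(ℝ, E) ∞ M]
  [ContMDiffVectorBundle ∞ F A 𝓘(ℝ, E)]

variable (E A) in
/-- Every vector `u` of the model fibre is, near `x`, the constant value of a global smooth section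
of `A` in the trivialization around `x`. -/
theorem exists_frameSection (x : M) (u : F) :
    ∃ s : GlobalSections E F A, ∀ᶠ y in 𝓝 x, s y = (trivializationAt F A x).symm y u := by
  set t := trivializationAt F A x
  have ht : t.baseSet ∈ 𝓝 x := t.open_baseSet.mem_nhds (FiberBundle.mem_baseSet_trivializationAt' x)
  obtain ⟨b, -, hb⟩ := (SmoothBumpFunction.nhds_basis_tsupport (I := 𝓘(ℝ, E)) x).mem_iff.1 ht
  have hs : ContMDiffOn 𝓘(ℝ, E) (𝓘(ℝ, E).prod 𝓘(ℝ, F)) ∞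
      (fun y => TotalSpace.mk' F y (t.symm y u)) t.baseSet := by
    intro y hy
    rw [t.contMDiffWithinAt_section _ hy]
    exact (contMDiffWithinAt_const (c := u)).congr (fun z hz => by simp [hz]) (by simp [hy])
  refine ⟨⟨_, b.contMDiff.contMDiffOn.smul_section_of_tsupport t.open_baseSet hb hs⟩, ?_⟩
  filter_upwards [b.eventuallyEq_one] with y hy
  have hy' : b y = 1 := hy
  simp [hy']

variable (E A) in
/-- A global smooth section of `A` that near `x` has the constant value `u` in the trivialization
around `x`. For `u` running through a basis of the model fibre, these sections form a local basis
of sections of `A` near `x`. -/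
def frameSection (x : M) (u : F) : GlobalSections E F A := (exists_frameSection E A x u).choose

variable (A) in
/-- The elements `e^i` at `x` of the basis dual to the local basis
`e_i = frameSection x (Module.finBasis ℝ F i)`. -/
def dualFrame [FiniteDimensional ℝ F] (x : M) (i : Fin (Module.finrank ℝ F)) : DualFiber A x :=
  ((Module.finBasis ℝ F).coord i).toContinuousLinearMap ∘L
    (trivializationAt F A x).continuousLinearMapAt ℝ x

/-- For a tangent vector `v = ∑ v^l ∂/∂x^l` of `M` at `x = π*(p)`, the vector `∑ v^l ∂/∂x^l` of `A*`
at `p`, in the fibred coordinates `(x^l, μ_j)` of the local basis around `x`: the derivative along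
`v` of the local section of `A*` through `p` on which all the `μ_j` are constant. -/
def coordVec (p : DualBundle F A) (v : TangentSpace 𝓘(ℝ, E) p.1) :
    TangentSpace (dualModel E F) p :=
  mfderiv 𝓘(ℝ, E) (dualModel E F)
    (fun y : M => (⟨y, FiberBundle.extend (F →L[ℝ] ℝ) p.2 y⟩ : DualBundle F A)) p.1 v

/-- The linear Poisson bivector `Λ_{A*}` of a Lie algebroid: in the fibred coordinates `(x^l, μ_j)`
given by a local basis of sections `e_i` with `[[e_i, e_j]] = ∑ k, c_ij^k e_k` and
`ρ(e_i) = ∑ l, ρ_i^l ∂/∂x^l`, it is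
`∑_{i<j} ∑_k c_ij^k μ_k ∂/∂μ_i ∧ ∂/∂μ_j + ∑_{i,l} ρ_i^l ∂/∂μ_i ∧ ∂/∂x^l`.
At `p` the number `∑_k c_ij^k μ_k` is `p([[e_i, e_j]])`, and `∂/∂μ_i` is the vertical lift of
`e^i`. -/
def LieAlgebroid.linearPoisson [FiniteDimensional ℝ F] (L : LieAlgebroid E F A)
    (p : DualBundle F A) : CotangentForm (dualModel E F) p :=
  let e (i : Fin (Module.finrank ℝ F)) : GlobalSections E F A :=
    frameSection E A p.1 (Module.finBasis ℝ F i)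
  let dμ (i : Fin (Module.finrank ℝ F)) : TangentSpace (dualModel E F) p :=
    verticalVec E p (dualFrame A p.1 i)
  ∑ i, ∑ j ∈ Finset.Ioi i,
      p.2 (L.bracket (e i) (e j) p.1) • wedgeVec (dualModel E F) (dμ i) (dμ j) +
    ∑ i, wedgeVec (dualModel E F) (dμ i) (coordVec p (L.anchor p.1 (e i p.1)))

/-- The bracket of a Jacobi structure on `A*` satisfies
`{μ̃, η̃} = [[μ, η]]~`, `{μ̃, f ∘ π*} = (ρ(μ)(f) + φ(μ) f) ∘ π*` and `{f ∘ π*, g ∘ π*} = 0`. -/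
structure LieAlgebroid.IsInducedBy (L : LieAlgebroid E F A) (φ : DualSections E F A)
    (J : JacobiStructure (dualModel E F) (DualBundle F A)) : Prop where
  linear_linear : ∀ μ η : GlobalSections E F A,
    J.bracket (linearFunction μ) (linearFunction η) = linearFunction (L.bracket μ η)
  linear_basic : ∀ (μ : GlobalSections E F A) (f : C^∞⟮𝓘(ℝ, E), M; ℝ⟯),
    J.bracket (linearFunction μ) (basicFunction F A f) =
      basicFunction F A
        (fun x => mvfderiv 𝓘(ℝ, E) f x (L.anchor x (μ x)) + φ x (μ x) * f x)
  basic_basic : ∀ f g : C^∞⟮𝓘(ℝ, E), M; ℝ⟯,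
    J.bracket (basicFunction F A f) (basicFunction F A g) = 0

end LinearPoisson

end Algebroid

end

/-! Near each point of `A*`, every linear combination of chart coordinates is the sum of a basic and
a linear function (`generatesCoordinates_generatorFunctions`). Hence these functions determine
vector fields and bivectors pointwise, and also detect their smoothness.

Existence: the pair `(Λ_{A*} + Δ ∧ φ^v, -φ^v)` is computed on generators.
`linearPoisson_linear_linear` gives the Lie-Poisson bracket. Since `Δ(μ̃) = μ̃` and `φ^v(μ̃) = φ(μ)
∘ π*`, the wedge adds `μ̃ φ(η) - φ(μ) η̃`, which the `E`-terms of the Jacobi bracket cancel again.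
On generators, the two Schouten identities amount to the Jacobi identity of the algebroid, the
compatibility of the anchor with brackets, and the cocycle condition.

The Schouten expressions contain second derivatives, so passing from generators to all smooth
functions needs an argument. With `X_g = Λ(·, dg)`, the second-order terms combine into commutators
such as `[X_h, X_g](f)`, which depend only on `df` (`along_commutator`). Thus the identities are
tensorial in each slot: `schoutenBivec_eq_of_generators` and
`schoutenVecBivec_eq_zero_of_generators`.

Uniqueness: bracketing with the constant function `1` recovers `E` on generators, and then the
bracket recovers `Λ` on pairs of generators. -/

open Bundle Manifold
open scoped ContDiff Topology

set_option maxSynthPendingDepth 3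

noncomputable section

/-! ### Vector fields as derivations of smooth functions -/

section General

variable {E : Type*} [NormedAddCommGroup E] [NormedSpace ℝ E]
  {H : Type*} [TopologicalSpace H] {I : ModelWithCorners ℝ E H}
  {N : Type*} [TopologicalSpace N] [ChartedSpace H N]

theorem mvfderiv_congr_of_eventuallyEq {f g : N → ℝ} {x : N} (h : f =ᶠ[𝓝 x] g) :
    mvfderiv I f x = mvfderiv I g x := by
  ext v
  have := h.mfderiv_eq (I := I) (I' := 𝓘(ℝ, ℝ))
  simp only [mvfderiv]
  exact congrArg (fun L : E →L[ℝ] ℝ => L v) this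

theorem mvfderiv_clm_comp {V : Type*} [NormedAddCommGroup V] [NormedSpace ℝ V]
    (α : V →L[ℝ] ℝ) {g : N → V} {x : N}
    (hg : MDifferentiableAt I 𝓘(ℝ, V) g x) (v : TangentSpace I x) :
    mvfderiv I (fun y => α (g y)) x v = α (mvfderiv I g x v) := by
  have h := mvfderiv_comp_apply (I := 𝓘(ℝ, V)) (I' := I) (g := (α : V → ℝ)) (f := g) x
    α.differentiableAt.mdifferentiableAt hg v
  refine h.trans ?_
  have h2 : mfderiv 𝓘(ℝ, V) 𝓘(ℝ, ℝ) α (g x) = α := by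
    rw [mfderiv_eq_fderiv, ContinuousLinearMap.fderiv]
  simp only [mvfderiv]
  exact congrArg (fun L : V →L[ℝ] ℝ => L (mfderiv I 𝓘(ℝ, V) g x v)) h2

variable [IsManifold I ∞ N]

theorem ContMDiff.along {X : ∀ x : N, TangentSpace I x} {f : N → ℝ}
    (hX : ContMDiff I I.tangent ∞ (fun x => (⟨x, X x⟩ : TangentBundle I N)))
    (hf : ContMDiff I 𝓘(ℝ, ℝ) ∞ f) : ContMDiff I 𝓘(ℝ, ℝ) ∞ (along I X f) := by
  have h1 := (hf.contMDiff_tangentMap (m := ∞) (n := ∞) (by simp)).comp hX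
  exact (contMDiff_snd_tangentBundle_modelSpace ℝ 𝓘(ℝ, ℝ)).comp h1

/-- In the tangent trivialization at `x₀` the fibre component of `X` is the derivative of the chart
along `X`. Expanding it in a basis of `E` leaves only derivatives of scalar coordinate functions. -/
theorem contMDiffAt_vectorField_of_coord [FiniteDimensional ℝ E]
    {X : ∀ x : N, TangentSpace I x} {x₀ : N}
    (h : ∀ α : E →L[ℝ] ℝ, ContMDiffAt I 𝓘(ℝ, ℝ) ∞
      (fun x => mvfderiv I (fun y => α (extChartAt I x₀ y)) x (X x)) x₀) :
    ContMDiffAt I I.tangent ∞ (fun x => (⟨x, X x⟩ : TangentBundle I N)) x₀ := by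
  rw [Bundle.contMDiffAt_section]
  have key : ∀ᶠ x in 𝓝 x₀, (trivializationAt E (TangentSpace I) x₀ ⟨x, X x⟩).2
      = mvfderiv I (extChartAt I x₀) x (X x) := by
    filter_upwards [(chartAt H x₀).open_source.mem_nhds (mem_chart_source H x₀)] with x hx
    have h1 := TangentBundle.continuousLinearMapAt_trivializationAt (I := I) hx
    have h2 := congrArg (fun L : E →L[ℝ] E => L (X x)) h1
    refine Eq.trans ?_ h2
    change _ = (trivializationAt E (TangentSpace I) x₀).continuousLinearMapAt ℝ x (X x)
    rw [Trivialization.continuousLinearMapAt_apply, Trivialization.coe_linearMapAt_of_mem]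
    simpa using hx
  refine ContMDiffAt.congr_of_eventuallyEq ?_ key
  let b := Module.finBasis ℝ E
  have : (fun x => (mvfderiv I (extChartAt I x₀) x (X x) : E)) =ᶠ[𝓝 x₀] fun x =>
      ∑ i, mvfderiv I (fun y => (b.coord i).toContinuousLinearMap (extChartAt I x₀ y)) x (X x) •
        b i := by
    filter_upwards [(chartAt H x₀).open_source.mem_nhds (mem_chart_source H x₀)] with x hx
    conv_lhs => rw [← b.sum_repr (mvfderiv I (extChartAt I x₀) x (X x))]
    refine Finset.sum_congr rfl fun i _ => ?_
    rw [mvfderiv_clm_comp _ (mdifferentiableAt_extChartAt hx)]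
    simp
  refine ContMDiffAt.congr_of_eventuallyEq ?_ this
  exact ContMDiffAt.sum fun i _ => (h _).smul contMDiffAt_const

/-- The commutator of the derivations of two vector fields is the derivation of their bracket. -/
theorem along_commutator [FiniteDimensional ℝ E] [I.Boundaryless]
    {X Y : ∀ x : N, TangentSpace I x} {f : N → ℝ}
    (hX : ContMDiff I I.tangent ∞ (fun x => (⟨x, X x⟩ : TangentBundle I N)))
    (hY : ContMDiff I I.tangent ∞ (fun x => (⟨x, Y x⟩ : TangentBundle I N)))
    (hf : ContMDiff I 𝓘(ℝ, ℝ) ∞ f) (x : N) :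
    along I X (along I Y f) x - along I Y (along I X f) x =
      mvfderiv I f x (VectorField.mlieBracket I X Y x) := by
  have two_le : (2 : WithTop ℕ∞) ≤ ∞ := WithTop.coe_le_coe.2 (le_top : (2 : ℕ∞) ≤ ⊤)
  have : IsManifold I 2 N := IsManifold.of_le (n := ∞) two_le
  set φ := extChartAt I x with hφ
  have hchart : ∀ g : N → ℝ, ContMDiff I 𝓘(ℝ, ℝ) ∞ g →
      (mvfderiv I g x : E →L[ℝ] ℝ) = fderiv ℝ (g ∘ φ.symm) (φ x) := by
    intro g hg
    refine (((hg x).mdifferentiableAt (by simp)).mvfderiv).trans ?_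
    rw [I.range_eq_univ, fderivWithin_univ]
    rfl
  have hfφ : ContDiffAt ℝ ∞ (f ∘ φ.symm) (φ x) := by
    have := (contMDiffAt_iff.1 (hf x)).2
    rw [I.range_eq_univ, contDiffWithinAt_univ] at this
    exact this
  -- The representative of `Z` in the chart at `x`: it has the value `Z x` at the centre, and the
  -- derivation `Z(f)` read in the chart is the ordinary derivative of `f ∘ φ.symm` along it.
  have hpull : ∀ Z : ∀ x : N, TangentSpace I x,
      ContMDiff I I.tangent ∞ (fun x => (⟨x, Z x⟩ : TangentBundle I N)) →
      ∃ Z' : E → E, Z' = VectorField.mpullbackWithin 𝓘(ℝ, E) I φ.symm Z (Set.range I) ∧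
        DifferentiableAt ℝ Z' (φ x) ∧ Z' (φ x) = Z x ∧
        (along I Z f) ∘ φ.symm =ᶠ[𝓝 (φ x)] fun y => fderiv ℝ (f ∘ φ.symm) y (Z' y) := by
    intro Z hZ
    refine ⟨_, rfl, ?_, ?_, ?_⟩
    · have := MDifferentiableWithinAt.differentiableWithinAt_mpullbackWithin_vectorField
        (s := Set.univ) (x := x) ((hZ x).mdifferentiableAt (by simp)).mdifferentiableWithinAt
      rw [Set.preimage_univ, Set.univ_inter, I.range_eq_univ] at this
      rw [I.range_eq_univ]
      exact this.differentiableAt (by simp)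
    · have h1 := mfderivWithin_extChartAt_symm_inverse_apply (I := I) (x := x) (Z x)
      have h2 : (extChartAt I x).symm (extChartAt I x x) = x := extChartAt_to_inv x
      rw [VectorField.mpullbackWithin_apply]
      have h3 : (Z (φ.symm (φ x)) : E) = Z x := by rw [h2]
      exact (congrArg (mfderivWithin 𝓘(ℝ, E) I φ.symm (Set.range I) (φ x)).inverse h3).trans h1
    · filter_upwards [extChartAt_target_mem_nhds (I := I) x] with y hy
      have h1 : (mfderivWithin 𝓘(ℝ, E) I φ.symm (Set.range I) y).IsInvertible :=
        isInvertible_mfderivWithin_extChartAt_symm hy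
      have h2 : MDifferentiableAt 𝓘(ℝ, E) I φ.symm y := by
        have := mdifferentiableWithinAt_extChartAt_symm (I := I) hy
        rwa [I.range_eq_univ, mdifferentiableWithinAt_univ] at this
      have h3 := mvfderiv_comp_apply (I' := 𝓘(ℝ, E)) (I := I) y
        ((hf (φ.symm y)).mdifferentiableAt (by simp)) h2
        (VectorField.mpullbackWithin 𝓘(ℝ, E) I φ.symm Z (Set.range I) y)
      have h4 : mvfderiv 𝓘(ℝ, E) (f ∘ φ.symm) y = fderiv ℝ (f ∘ φ.symm) y := by
        ext v
        simp [mvfderiv, mfderiv_eq_fderiv]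
        rfl
      rw [h4] at h3
      refine Eq.trans ?_ h3.symm
      rw [VectorField.mpullbackWithin_apply, ← mfderivWithin_univ, ← I.range_eq_univ]
      rw [h1.self_apply_inverse]
      rfl
  obtain ⟨X', hX', dX, eX, aX⟩ := hpull X hX
  obtain ⟨Y', hY', dY, eY, aY⟩ := hpull Y hY
  -- The manifold bracket is the vector space bracket transported by the chart, and the derivative
  -- of the chart at its own centre is the identity.
  have hbr : (VectorField.mlieBracket I X Y x : E) = VectorField.lieBracket ℝ X' Y' (φ x) := by
    have h6 : (mfderiv I 𝓘(ℝ, E) (extChartAt I x) x : E →L[ℝ] E).inverse =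
        ContinuousLinearMap.id ℝ E := by
      rw [← ContinuousLinearMap.inverse_id]
      exact congrArg (ContinuousLinearMap.inverse (M := E) (M₂ := E)) mfderiv_extChartAt_self
    have h7 := congrArg (fun L : E →L[ℝ] E => L (VectorField.lieBracket ℝ X' Y' (φ x))) h6
    refine Eq.trans ?_ h7
    rw [← VectorField.mlieBracketWithin_univ, VectorField.mlieBracketWithin_apply, ← hφ,
      ← hX', ← hY', Set.preimage_univ,
      Set.univ_inter, I.range_eq_univ, VectorField.lieBracketWithin_univ]
    rfl
  have hdf : DifferentiableAt ℝ (fderiv ℝ (f ∘ φ.symm)) (φ x) :=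
    (hfφ.fderiv_right (m := 1) (by rw [one_add_one_eq_two]; exact two_le)).differentiableAt
      (by simp)
  have hsymm : IsSymmSndFDerivAt ℝ (f ∘ φ.symm) (φ x) :=
    hfφ.isSymmSndFDerivAt (by simpa using two_le)
  have hder : ∀ V W : ∀ x : N, TangentSpace I x, ∀ V' W' : E → E, V' (φ x) = V x →
      ContMDiff I 𝓘(ℝ, ℝ) ∞ (along I W f) → DifferentiableAt ℝ W' (φ x) →
      (along I W f) ∘ φ.symm =ᶠ[𝓝 (φ x)] (fun y => fderiv ℝ (f ∘ φ.symm) y (W' y)) →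
      along I V (along I W f) x = fderiv ℝ (f ∘ φ.symm) (φ x) (fderiv ℝ W' (φ x) (V' (φ x))) +
        fderiv ℝ (fderiv ℝ (f ∘ φ.symm)) (φ x) (V' (φ x)) (W' (φ x)) := by
    intro V W V' W' eV hW dW aW
    have h1 := congrArg (fun L : E →L[ℝ] ℝ => L (V x)) (hchart _ hW)
    refine h1.trans ?_
    rw [aW.fderiv_eq, fderiv_clm_apply hdf dW, ← eV]
    simp
  -- The second derivatives of `f` cancel by symmetry; the remaining first-order terms are `df` of
  -- the bracket.
  rw [hder X Y X' Y' eX (hY.along hf) dY aY, hder Y X Y' X' eY (hX.along hf) dX aX,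
    hsymm.eq (X' (φ x)) (Y' (φ x))]
  have h5 := congrArg (fun L : E →L[ℝ] ℝ => L (VectorField.mlieBracket I X Y x)) (hchart _ hf)
  refine Eq.trans ?_ h5.symm
  rw [hbr, VectorField.lieBracket_eq]
  simp

end General

/-- Reflexivity in finite dimension. It turns contractions of bivectors into tangent vectors, and
functionals on `F*` into vectors of `F`. -/
theorem exists_eq_apply_of_dual {V : Type*} [NormedAddCommGroup V] [NormedSpace ℝ V]
    [FiniteDimensional ℝ V] (Φ : (V →L[ℝ] ℝ) →ₗ[ℝ] ℝ) : ∃ v : V, ∀ α : V →L[ℝ] ℝ, α v = Φ α := by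
  let b := Module.finBasis ℝ V
  refine ⟨∑ i, Φ (b.coord i).toContinuousLinearMap • b i, fun α => ?_⟩
  have hα : α = ∑ i, α (b i) • (b.coord i).toContinuousLinearMap := by
    ext v
    conv_lhs => rw [← b.sum_repr v, map_sum]
    simp [mul_comm]
  conv_rhs => rw [hα]
  simp [mul_comm]

/-! ### Trivializations of the dual bundle -/

section DualTrivialization

variable {M : Type*} [TopologicalSpace M]
  {F : Type*} [NormedAddCommGroup F] [NormedSpace ℝ F]
  {A : M → Type*} [∀ x, AddCommGroup (A x)] [∀ x, Module ℝ (A x)] [∀ x, TopologicalSpace (A x)]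
  [TopologicalSpace (TotalSpace F A)] [FiberBundle F A] [VectorBundle ℝ F A]

theorem mem_baseSet_dual_trivializationAt {x₀ x : M} (hx : x ∈ (trivializationAt F A x₀).baseSet) :
    x ∈ (trivializationAt (F →L[ℝ] ℝ) (fun x => A x →L[ℝ] ℝ) x₀).baseSet := by
  rw [hom_trivializationAt_baseSet]
  exact ⟨hx, Set.mem_univ x⟩

theorem dual_trivializationAt_snd {x₀ x : M} (θ : A x →L[ℝ] ℝ) :
    (trivializationAt (F →L[ℝ] ℝ) (fun x => A x →L[ℝ] ℝ) x₀ ⟨x, θ⟩).2 =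
      θ ∘L (trivializationAt F A x₀).symmL ℝ x := by
  rw [hom_trivializationAt_apply]
  ext u
  simp [ContinuousLinearMap.inCoordinates]

theorem dual_continuousLinearMapAt {x₀ x : M} (hx : x ∈ (trivializationAt F A x₀).baseSet)
    (θ : A x →L[ℝ] ℝ) :
    (trivializationAt (F →L[ℝ] ℝ) (fun x => A x →L[ℝ] ℝ) x₀).continuousLinearMapAt ℝ x θ =
      θ ∘L (trivializationAt F A x₀).symmL ℝ x := by
  rw [Trivialization.continuousLinearMapAt_apply,
    Trivialization.coe_linearMapAt_of_mem _ (mem_baseSet_dual_trivializationAt hx)]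
  exact dual_trivializationAt_snd θ

/-- The dual trivialization is precomposition with the inverse trivialization of `A`, so its inverse
is precomposition with the trivialization itself. -/
theorem dual_symmL {x₀ x : M} (hx : x ∈ (trivializationAt F A x₀).baseSet)
    (w : F →L[ℝ] ℝ) :
    (trivializationAt (F →L[ℝ] ℝ) (fun x => A x →L[ℝ] ℝ) x₀).symmL ℝ x w =
      w ∘L (trivializationAt F A x₀).continuousLinearMapAt ℝ x := by
  have h : w = (trivializationAt (F →L[ℝ] ℝ) (fun x => A x →L[ℝ] ℝ) x₀).continuousLinearMapAt ℝ x
      (w ∘L (trivializationAt F A x₀).continuousLinearMapAt ℝ x) := by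
    rw [dual_continuousLinearMapAt hx]
    ext u
    simp [Trivialization.continuousLinearMapAt_symmL _ hx]
  conv_lhs => rw [h]
  exact Trivialization.symmL_continuousLinearMapAt _ (mem_baseSet_dual_trivializationAt hx) _

end DualTrivialization

/-! ### Contraction and smoothness of bivector fields -/

section General

variable {E : Type*} [NormedAddCommGroup E] [NormedSpace ℝ E] [FiniteDimensional ℝ E]
  {H : Type*} [TopologicalSpace H] {I : ModelWithCorners ℝ E H}
  {N : Type*} [TopologicalSpace N] [ChartedSpace H N]

theorem exists_sharp {x : N} (Λ : CotangentForm I x) (β : Cotangent I x) :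
    ∃ v : TangentSpace I x, ∀ α : Cotangent I x, α v = Λ α β :=
  exists_eq_apply_of_dual (V := E)
    (((ContinuousLinearMap.flip (E := E →L[ℝ] ℝ) (F := E →L[ℝ] ℝ) Λ) β).toLinearMap)

/-- The contraction of a bivector with a covector in its second slot. -/
def sharp {x : N} (Λ : CotangentForm I x) (β : Cotangent I x) : TangentSpace I x :=
  (exists_sharp Λ β).choose

@[simp] theorem apply_sharp {x : N} (Λ : CotangentForm I x) (α β : Cotangent I x) :
    α (sharp Λ β) = Λ α β := (exists_sharp Λ β).choose_spec α

variable [IsManifold I ∞ N]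

/-- A constant covector `α` in the cotangent trivialization is the differential of `α` composed with
the chart. The matrix entries of `Λ` in this trivialization are therefore its pairings of coordinate
functions. -/
theorem contMDiffAt_bivec_of_coord {Λ : ∀ x : N, CotangentForm I x} {x₀ : N}
    (h : ∀ α β : E →L[ℝ] ℝ, ContMDiffAt I 𝓘(ℝ, ℝ) ∞
      (pairing I Λ (fun y => α (extChartAt I x₀ y)) (fun y => β (extChartAt I x₀ y))) x₀) :
    ContMDiffAt I (I.prod 𝓘(ℝ, (E →L[ℝ] ℝ) →L[ℝ] (E →L[ℝ] ℝ) →L[ℝ] ℝ)) ∞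
    (fun x => TotalSpace.mk' ((E →L[ℝ] ℝ) →L[ℝ] (E →L[ℝ] ℝ) →L[ℝ] ℝ)
      (E := fun x : N => CotangentForm I x) x (Λ x)) x₀ := by
  rw [contMDiffAt_hom_bundle]
  refine ⟨contMDiffAt_id, ?_⟩
  let b := Module.finBasis ℝ (E →L[ℝ] ℝ)
  have expand : ∀ T : (E →L[ℝ] ℝ) →L[ℝ] (E →L[ℝ] ℝ) →L[ℝ] ℝ, T = ∑ i, ∑ j, T (b i) (b j) •
      (b.coord i).toContinuousLinearMap.smulRight (b.coord j).toContinuousLinearMap := by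
    intro T
    ext α β
    conv_lhs => rw [← b.sum_repr α, map_sum, sum_apply]
    rw [sum_apply, sum_apply]
    refine Finset.sum_congr rfl fun i _ => ?_
    rw [sum_apply, sum_apply]
    conv_lhs => rw [← b.sum_repr β, map_sum]
    refine Finset.sum_congr rfl fun j _ => ?_
    simp only [map_smul, smul_apply, smul_eq_mul,
      ContinuousLinearMap.smulRight_apply, LinearMap.coe_toContinuousLinearMap',
      Module.Basis.coord_apply]
    ring
  have key : ∀ᶠ x in 𝓝 x₀, ∀ α β : E →L[ℝ] ℝ, ContinuousLinearMap.inCoordinates (E →L[ℝ] ℝ)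
      (fun x : N => Cotangent I x) ((E →L[ℝ] ℝ) →L[ℝ] ℝ)
      (fun x : N => Cotangent I x →L[ℝ] ℝ) x₀ x x₀ x (Λ x) α β =
      pairing I Λ (fun y => α (extChartAt I x₀ y)) (fun y => β (extChartAt I x₀ y)) x := by
    filter_upwards [(chartAt H x₀).open_source.mem_nhds (mem_chart_source H x₀)] with x hx α β
    have hsymm : ∀ α : E →L[ℝ] ℝ,
        (trivializationAt (E →L[ℝ] ℝ) (fun x : N => Cotangent I x) x₀).symmL ℝ x α =
          mvfderiv I (fun y => α (extChartAt I x₀ y)) x := by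
      intro α
      have hx' : x ∈ (trivializationAt E (TangentSpace I) x₀).baseSet := by simpa using hx
      rw [dual_symmL hx']
      ext v
      rw [mvfderiv_clm_comp _ (mdifferentiableAt_extChartAt hx)]
      exact congrArg (fun L : E →L[ℝ] E => α (L v))
        (TangentBundle.continuousLinearMapAt_trivializationAt (I := I) hx)
    have hx' : x ∈ (trivializationAt (E →L[ℝ] ℝ) (fun x : N => Cotangent I x) x₀).baseSet :=
      mem_baseSet_dual_trivializationAt (by simpa using hx)
    rw [ContinuousLinearMap.inCoordinates]
    simp only [ContinuousLinearMap.comp_apply]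
    rw [dual_continuousLinearMapAt hx']
    simp only [ContinuousLinearMap.comp_apply]
    rw [hsymm, hsymm]
    rfl
  have h2 : ContMDiffAt I 𝓘(ℝ, (E →L[ℝ] ℝ) →L[ℝ] (E →L[ℝ] ℝ) →L[ℝ] ℝ) ∞ (fun x => ∑ i, ∑ j,
      pairing I Λ (fun y => b i (extChartAt I x₀ y)) (fun y => b j (extChartAt I x₀ y)) x •
      (b.coord i).toContinuousLinearMap.smulRight (b.coord j).toContinuousLinearMap) x₀ :=
    ContMDiffAt.sum fun i _ => ContMDiffAt.sum fun j _ => (h (b i) (b j)).smul contMDiffAt_const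
  refine h2.congr_of_eventuallyEq ?_
  filter_upwards [key] with x hx
  refine (expand _).trans ?_
  exact Finset.sum_congr rfl fun i _ => Finset.sum_congr rfl fun j _ => congrArg (· • _) (hx _ _)

end General

/-! ### Testing tensors on functions that generate the coordinates -/

section Generators

variable {E : Type*} [NormedAddCommGroup E] [NormedSpace ℝ E]
  {H : Type*} [TopologicalSpace H] {I : ModelWithCorners ℝ E H}
  {N : Type*} [TopologicalSpace N] [ChartedSpace H N]

variable (I) in
/-- A set of smooth functions such that near every point, every linear combination of the
coordinates of the chart is a sum of two functions of the set. -/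
structure GeneratesCoordinates (𝒢 : Set (N → ℝ)) : Prop where
  contMDiff : ∀ f ∈ 𝒢, ContMDiff I 𝓘(ℝ, ℝ) ∞ f
  exists_add : ∀ (x : N) (α : E →L[ℝ] ℝ), ∃ f ∈ 𝒢, ∃ g ∈ 𝒢,
    (fun y => α (extChartAt I x y)) =ᶠ[𝓝 x] fun y => f y + g y

namespace GeneratesCoordinates

variable {𝒢 : Set (N → ℝ)} (h𝒢 : GeneratesCoordinates I 𝒢)
include h𝒢

theorem mdifferentiableAt {f : N → ℝ} (hf : f ∈ 𝒢) (x : N) : MDifferentiableAt I 𝓘(ℝ, ℝ) f x :=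
  (h𝒢.contMDiff f hf x).mdifferentiableAt (by simp)

theorem exists_mvfderiv_eq (x : N) (α : E →L[ℝ] ℝ) : ∃ f ∈ 𝒢, ∃ g ∈ 𝒢,
    ∀ᶠ y in 𝓝 x, mvfderiv I (fun y => α (extChartAt I x y)) y =
      mvfderiv I f y + mvfderiv I g y := by
  obtain ⟨f, hf, g, hg, h⟩ := h𝒢.exists_add x α
  refine ⟨f, hf, g, hg, ?_⟩
  filter_upwards [h.eventuallyEq_nhds] with y hy
  rw [mvfderiv_congr_of_eventuallyEq hy,
    mvfderiv_fun_add (h𝒢.mdifferentiableAt hf y) (h𝒢.mdifferentiableAt hg y)]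

variable [IsManifold I ∞ N]

/-- The derivative of the chart at its own centre is the identity, so `α` is the differential there
of `α` composed with the chart. -/
theorem exists_covector_eq (x : N) (α : Cotangent I x) : ∃ f ∈ 𝒢, ∃ g ∈ 𝒢,
    α = mvfderiv I f x + mvfderiv I g x := by
  obtain ⟨f, hf, g, hg, h⟩ := h𝒢.exists_mvfderiv_eq x α
  refine ⟨f, hf, g, hg, ?_⟩
  rw [← h.self_of_nhds]
  ext v
  refine Eq.trans ?_ (mvfderiv_clm_comp (V := E) α
    (mdifferentiableAt_extChartAt (mem_chart_source H x)) v).symm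
  exact congrArg (fun L : E →L[ℝ] E => α (L v)) (mfderiv_extChartAt_self (I := I) (x := x)).symm

theorem linear_eq_zero {x : N} (ℓ : Cotangent I x →ₗ[ℝ] ℝ)
    (h : ∀ f ∈ 𝒢, ℓ (mvfderiv I f x) = 0) (α : Cotangent I x) : ℓ α = 0 := by
  obtain ⟨f, hf, g, hg, rfl⟩ := h𝒢.exists_covector_eq x α
  rw [map_add, h f hf, h g hg, add_zero]

theorem vec_ext {x : N} {X Y : TangentSpace I x}
    (h : ∀ f ∈ 𝒢, mvfderiv I f x X = mvfderiv I f x Y) : X = Y := by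
  have key : ∀ α : E →L[ℝ] ℝ, α X = α Y := by
    intro α
    obtain ⟨f, hf, g, hg, e⟩ := h𝒢.exists_covector_eq x α
    have h1 := congrArg (fun L : E →L[ℝ] ℝ => L X) e
    have h2 := congrArg (fun L : E →L[ℝ] ℝ => L Y) e
    exact h1.trans ((congrArg₂ (· + ·) (h f hf) (h g hg)).trans h2.symm)
  exact (SeparatingDual.eq_iff_forall_dual_eq (R := ℝ) (V := E)).2 key

theorem bivec_ext {x : N} {P Q : CotangentForm I x}
    (h : ∀ f ∈ 𝒢, ∀ g ∈ 𝒢, P (mvfderiv I f x) (mvfderiv I g x) =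
      Q (mvfderiv I f x) (mvfderiv I g x)) : P = Q := by
  ext α β
  obtain ⟨f, hf, g, hg, rfl⟩ := h𝒢.exists_covector_eq x α
  obtain ⟨f', hf', g', hg', rfl⟩ := h𝒢.exists_covector_eq x β
  simp only [map_add, add_apply]
  rw [h f hf f' hf', h f hf g' hg', h g hg f' hf', h g hg g' hg']

variable [FiniteDimensional ℝ E]

theorem contMDiff_vec {X : ∀ x : N, TangentSpace I x}
    (h : ∀ f ∈ 𝒢, ContMDiff I 𝓘(ℝ, ℝ) ∞ (along I X f)) :
    ContMDiff I I.tangent ∞ (fun x => (⟨x, X x⟩ : TangentBundle I N)) := by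
  intro x
  refine contMDiffAt_vectorField_of_coord fun α => ?_
  obtain ⟨f, hf, g, hg, e⟩ := h𝒢.exists_mvfderiv_eq x α
  refine ((h f hf x).add (h g hg x)).congr_of_eventuallyEq ?_
  filter_upwards [e] with y hy
  rw [hy]; rfl

theorem contMDiff_bivec {Λ : ∀ x : N, CotangentForm I x}
    (h : ∀ f ∈ 𝒢, ∀ g ∈ 𝒢, ContMDiff I 𝓘(ℝ, ℝ) ∞ (pairing I Λ f g)) :
    ContMDiff I (I.prod 𝓘(ℝ, (E →L[ℝ] ℝ) →L[ℝ] (E →L[ℝ] ℝ) →L[ℝ] ℝ)) ∞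
    (fun x => TotalSpace.mk' ((E →L[ℝ] ℝ) →L[ℝ] (E →L[ℝ] ℝ) →L[ℝ] ℝ)
      (E := fun x : N => CotangentForm I x) x (Λ x)) := by
  intro x
  refine contMDiffAt_bivec_of_coord fun α β => ?_
  obtain ⟨f, hf, g, hg, e⟩ := h𝒢.exists_mvfderiv_eq x α
  obtain ⟨f', hf', g', hg', e'⟩ := h𝒢.exists_mvfderiv_eq x β
  refine (((h f hf f' hf' x).add (h f hf g' hg' x)).add
    ((h g hg f' hf' x).add (h g hg g' hg' x))).congr_of_eventuallyEq ?_
  filter_upwards [e, e'] with y hy hy'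
  rw [pairing, hy, hy']
  simp only [map_add, add_apply, pairing, Pi.add_apply]
  ring

end GeneratesCoordinates
end Generators

/-! ### Tensoriality of the Schouten identities -/

section Alternating

variable {E : Type*} [NormedAddCommGroup E] [NormedSpace ℝ E]
  {H : Type*} [TopologicalSpace H] {I : ModelWithCorners ℝ E H}
  {N : Type*} [TopologicalSpace N] [ChartedSpace H N]
  {Λ : ∀ x : N, CotangentForm I x} (hΛ : ∀ (x : N) (α : Cotangent I x), Λ x α α = 0)
include hΛ

theorem bivec_swap (x : N) (α β : Cotangent I x) : Λ x α β = -Λ x β α := by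
  have h := hΛ x (α + β)
  simp only [map_add, add_apply, hΛ, zero_add, add_zero] at h
  linarith

theorem pairing_swap (f g : N → ℝ) : pairing I Λ f g = -pairing I Λ g f :=
  funext fun _ => bivec_swap hΛ _ _ _

variable [IsManifold I ∞ N] [FiniteDimensional ℝ E]
  {𝒢 : Set (N → ℝ)} (h𝒢 : GeneratesCoordinates I 𝒢)
  (hsm : ∀ f ∈ 𝒢, ∀ g ∈ 𝒢, ContMDiff I 𝓘(ℝ, ℝ) ∞ (pairing I Λ f g))
include h𝒢 hsm

/-- Smoothness is assumed only for pairings of two generators, while `g` is arbitrary. Antisymmetry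
exchanges the roles: for a generator `f` the field `Λ(·, df)` is smooth by testing on generators,
hence so is its derivative of `g`, which is `-Λ(df, dg)`. -/
theorem contMDiff_sharp {g : N → ℝ} (hg : ContMDiff I 𝓘(ℝ, ℝ) ∞ g) :
    ContMDiff I I.tangent ∞
      (fun x => (⟨x, sharp (Λ x) (mvfderiv I g x)⟩ : TangentBundle I N)) := by
  have key : ∀ f g : N → ℝ, along I (fun x => sharp (Λ x) (mvfderiv I g x)) f = pairing I Λ f g :=
    fun f g => funext fun x => apply_sharp _ _ _
  refine h𝒢.contMDiff_vec fun f hf => ?_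
  rw [key, pairing_swap hΛ, ← key]
  refine (ContMDiff.along ?_ hg).neg
  refine h𝒢.contMDiff_vec fun f' hf' => ?_
  rw [key]
  exact hsm f' hf' f hf

variable [I.Boundaryless]

/-- As a function of its first argument, `[Λ, Λ] - 2 X ∧ Λ` depends only on the differential. -/
theorem exists_schoutenBivec_eq {g h : N → ℝ} (hg : ContMDiff I 𝓘(ℝ, ℝ) ∞ g)
    (hh : ContMDiff I 𝓘(ℝ, ℝ) ∞ h) (x : N) (X : TangentSpace I x) :
    ∃ ℓ : Cotangent I x →ₗ[ℝ] ℝ, ∀ f : N → ℝ, ContMDiff I 𝓘(ℝ, ℝ) ∞ f →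
      schoutenBivec I Λ Λ f g h x -
        2 * wedgeVecBivec I X (Λ x) (mvfderiv I f x) (mvfderiv I g x) (mvfderiv I h x) =
      ℓ (mvfderiv I f x) := by
  set Xg := fun x => sharp (Λ x) (mvfderiv I g x) with hXg
  set Xh := fun x => sharp (Λ x) (mvfderiv I h x) with hXh
  have key : ∀ f g : N → ℝ, along I (fun x => sharp (Λ x) (mvfderiv I g x)) f = pairing I Λ f g :=
    fun f g => funext fun x => apply_sharp _ _ _
  let β := mvfderiv I g x
  let γ := mvfderiv I h x
  refine ⟨{
    toFun := fun α => 2 * (α (VectorField.mlieBracket I Xh Xg x)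
       - Λ x α (mvfderiv I (pairing I Λ g h) x)) - 2 * wedgeVecBivec I X (Λ x) α β γ
    map_add' := fun α α' => by
      simp only [wedgeVecBivec, map_add, add_apply]; ring
    map_smul' := fun c α => by
      simp only [wedgeVecBivec, map_smul, smul_apply, smul_eq_mul, RingHom.id_apply]; ring }, ?_⟩
  intro f hf
  -- Of the three cyclic terms, two are iterated derivatives of `f` and add up to the commutator
  -- `[Xh, Xg](f)`; the third involves only `df`. The factor 2 in `ℓ` comes from taking `P = Q = Λ`.
  have h1 : pairing I Λ (pairing I Λ f g) h x = along I Xh (along I Xg f) x := by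
    rw [key, key]
  have h2 : pairing I Λ (pairing I Λ h f) g x = -along I Xg (along I Xh f) x := by
    rw [key, key, pairing_swap hΛ h f]
    simp only [pairing, mvfderiv_neg, map_neg, neg_apply]
  have h3 : pairing I Λ (pairing I Λ g h) f x =
      -Λ x (mvfderiv I f x) (mvfderiv I (pairing I Λ g h) x) :=
    bivec_swap hΛ _ _ _
  have h4 := along_commutator (contMDiff_sharp hΛ h𝒢 hsm hh) (contMDiff_sharp hΛ h𝒢 hsm hg) hf x
  simp only [schoutenBivec, Pi.add_apply, LinearMap.coe_mk, AddHom.coe_mk]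
  rw [h1, h2, h3, ← h4]
  ring

/-- The identity `[Λ, Λ] = 2 X ∧ Λ` can be tested on functions that generate the coordinates. -/
theorem schoutenBivec_eq_of_generators (X : ∀ x : N, TangentSpace I x)
    (hgen : ∀ f ∈ 𝒢, ∀ g ∈ 𝒢, ∀ h ∈ 𝒢, ∀ x, schoutenBivec I Λ Λ f g h x =
        2 * wedgeVecBivec I (X x) (Λ x) (mvfderiv I f x) (mvfderiv I g x) (mvfderiv I h x))
    {f g h : N → ℝ} (hf : ContMDiff I 𝓘(ℝ, ℝ) ∞ f) (hg : ContMDiff I 𝓘(ℝ, ℝ) ∞ g)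
    (hh : ContMDiff I 𝓘(ℝ, ℝ) ∞ h) (x : N) :
    schoutenBivec I Λ Λ f g h x =
      2 * wedgeVecBivec I (X x) (Λ x) (mvfderiv I f x) (mvfderiv I g x) (mvfderiv I h x) := by
  let D (f g h : N → ℝ) : ℝ := schoutenBivec I Λ Λ f g h x -
      2 * wedgeVecBivec I (X x) (Λ x) (mvfderiv I f x) (mvfderiv I g x) (mvfderiv I h x)
  -- Generators are replaced by arbitrary functions one slot at a time. Only the first slot is
  -- treated directly; cyclic invariance rotates each of the others into it.
  have cyc : ∀ f g h, D f g h = D g h f := by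
    intro f g h
    simp only [D, schoutenBivec, wedgeVecBivec, Pi.add_apply]
    ring
  have ext : ∀ g h, ContMDiff I 𝓘(ℝ, ℝ) ∞ g → ContMDiff I 𝓘(ℝ, ℝ) ∞ h →
      (∀ f ∈ 𝒢, D f g h = 0) → ∀ f, ContMDiff I 𝓘(ℝ, ℝ) ∞ f → D f g h = 0 := by
    intro g h hg hh h0 f hf
    obtain ⟨ℓ, hℓ⟩ := exists_schoutenBivec_eq hΛ h𝒢 hsm hg hh x (X x)
    refine (hℓ f hf).trans (h𝒢.linear_eq_zero ℓ (fun f' hf' => ?_) _)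
    rw [← hℓ f' (h𝒢.contMDiff f' hf')]
    exact h0 f' hf'
  have hD : ∀ f ∈ 𝒢, ∀ g ∈ 𝒢, ∀ h ∈ 𝒢, D f g h = 0 := fun f hf g hg h hh =>
    sub_eq_zero.2 (hgen f hf g hg h hh x)
  have s1 : ∀ g ∈ 𝒢, ∀ h ∈ 𝒢, D f g h = 0 := fun g hg h hh =>
    ext g h (h𝒢.contMDiff g hg) (h𝒢.contMDiff h hh) (fun f' hf' => hD f' hf' g hg h hh) f hf
  have s2 : ∀ h ∈ 𝒢, D f g h = 0 := fun h hh => by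
    rw [cyc]
    exact ext h f (h𝒢.contMDiff h hh) hf (fun g' hg' => by rw [← cyc]; exact s1 g' hg' h hh) g hg
  refine sub_eq_zero.1 (?_ : D f g h = 0)
  rw [cyc, cyc]
  exact ext f g hf hg (fun h' hh' => by rw [← cyc, ← cyc]; exact s2 h' hh') h hh

/-- The identity `[X, Λ] = 0` can be tested on functions that generate the coordinates. -/
theorem schoutenVecBivec_eq_zero_of_generators {X : ∀ x : N, TangentSpace I x}
    (hX : ContMDiff I I.tangent ∞ (fun x => (⟨x, X x⟩ : TangentBundle I N)))
    (hgen : ∀ f ∈ 𝒢, ∀ g ∈ 𝒢, ∀ x, schoutenVecBivec I X Λ f g x = 0)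
    {f g : N → ℝ} (hf : ContMDiff I 𝓘(ℝ, ℝ) ∞ f) (hg : ContMDiff I 𝓘(ℝ, ℝ) ∞ g) (x : N) :
    schoutenVecBivec I X Λ f g x = 0 := by
  have key : ∀ f g : N → ℝ, along I (fun x => sharp (Λ x) (mvfderiv I g x)) f = pairing I Λ f g :=
    fun f g => funext fun x => apply_sharp _ _ _
  have swap : ∀ f g, schoutenVecBivec I X Λ f g x = - schoutenVecBivec I X Λ g f x := by
    intro f g
    rw [schoutenVecBivec, pairing_swap hΛ f g, pairing_swap hΛ _ g, pairing_swap hΛ f]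
    simp only [schoutenVecBivec, along, Pi.sub_apply, Pi.neg_apply, mvfderiv_neg, neg_apply]
    ring
  have ext : ∀ g, ContMDiff I 𝓘(ℝ, ℝ) ∞ g → (∀ f ∈ 𝒢, schoutenVecBivec I X Λ f g x = 0) →
      ∀ f, ContMDiff I 𝓘(ℝ, ℝ) ∞ f → schoutenVecBivec I X Λ f g x = 0 := by
    intro g hg h0
    set Xg := fun x => sharp (Λ x) (mvfderiv I g x) with hXg
    -- `X(Λ(df, dg)) - Λ(d(Xf), dg)` is the commutator `[X, Xg](f)`, so only `df` matters.
    let ℓ : Cotangent I x →ₗ[ℝ] ℝ := {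
      toFun := fun α => α (VectorField.mlieBracket I X Xg x) - Λ x α (mvfderiv I (along I X g) x)
      map_add' := fun α α' => by simp only [map_add, add_apply]; ring
      map_smul' := fun c α => by
        simp only [map_smul, smul_apply, smul_eq_mul, RingHom.id_apply]; ring }
    have hℓ : ∀ f, ContMDiff I 𝓘(ℝ, ℝ) ∞ f → schoutenVecBivec I X Λ f g x = ℓ (mvfderiv I f x) := by
      intro f hf
      have h4 := along_commutator hX (contMDiff_sharp hΛ h𝒢 hsm hg) hf x
      simp only [schoutenVecBivec, Pi.sub_apply, LinearMap.coe_mk, AddHom.coe_mk, ℓ]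
      rw [← h4, key, key]
      rfl
    intro f hf
    refine (hℓ f hf).trans (h𝒢.linear_eq_zero ℓ (fun f' hf' => ?_) _)
    rw [← hℓ f' (h𝒢.contMDiff f' hf')]
    exact h0 f' hf'
  refine ext g hg (fun f' hf' => ?_) f hf
  rw [swap, neg_eq_zero]
  exact ext f' (h𝒢.contMDiff f' hf') (fun g' hg' => hgen g' hg' f' hf' x) g hg

end Alternating

/-! ### Linear and basic functions on the dual bundle -/

section DualBundle

variable {E : Type*} [NormedAddCommGroup E] [NormedSpace ℝ E]
  {M : Type*} [TopologicalSpace M] [ChartedSpace E M]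
  {F : Type*} [NormedAddCommGroup F] [NormedSpace ℝ F]
  {A : M → Type*} [∀ x, AddCommGroup (A x)] [∀ x, Module ℝ (A x)] [∀ x, TopologicalSpace (A x)]
  [TopologicalSpace (TotalSpace F A)] [FiberBundle F A] [VectorBundle ℝ F A]

theorem contMDiff_basicFunction {f : M → ℝ} (hf : ContMDiff 𝓘(ℝ, E) 𝓘(ℝ, ℝ) ∞ f) :
    ContMDiff (dualModel E F) 𝓘(ℝ, ℝ) ∞ (basicFunction F A f) :=
  hf.comp (contMDiff_proj (IB := 𝓘(ℝ, E)) (F := F →L[ℝ] ℝ) (DualFiber A))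

theorem contMDiff_dual_apply {B : Type*} [NormedAddCommGroup B] [NormedSpace ℝ B]
    {H : Type*} [TopologicalSpace H] {J : ModelWithCorners ℝ B H}
    {N : Type*} [TopologicalSpace N] [ChartedSpace H N] {b : N → M} {θ : ∀ m, DualFiber A (b m)}
    {v : ∀ m, A (b m)}
    (hθ : ContMDiff J (dualModel E F) ∞ (fun m => (⟨b m, θ m⟩ : DualBundle F A)))
    (hv : ContMDiff J (𝓘(ℝ, E).prod 𝓘(ℝ, F)) ∞ (fun m => (⟨b m, v m⟩ : TotalSpace F A))) :
    ContMDiff J 𝓘(ℝ, ℝ) ∞ (fun m => θ m (v m)) := by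
  have h := ContMDiff.clm_bundle_apply (F₂ := ℝ) (E₂ := Bundle.Trivial M ℝ) hθ hv
  intro m
  exact ((contMDiffAt_totalSpace).1 (h m)).2

theorem contMDiff_dualSection_apply (φ : DualSections E F A) (μ : GlobalSections E F A) :
    ContMDiff 𝓘(ℝ, E) 𝓘(ℝ, ℝ) ∞ (fun x => φ x (μ x)) :=
  contMDiff_dual_apply φ.contMDiff μ.contMDiff

theorem contMDiff_linearFunction (μ : GlobalSections E F A) :
    ContMDiff (dualModel E F) 𝓘(ℝ, ℝ) ∞ (linearFunction μ) :=
  contMDiff_dual_apply contMDiff_id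
    (μ.contMDiff.comp (contMDiff_proj (IB := 𝓘(ℝ, E)) (F := F →L[ℝ] ℝ) (DualFiber A)))

theorem mdifferentiableAt_linearFunction (μ : GlobalSections E F A) (p : DualBundle F A) :
    MDifferentiableAt (dualModel E F) 𝓘(ℝ, ℝ) (linearFunction μ) p :=
  (contMDiff_linearFunction μ p).mdifferentiableAt (by simp)

theorem mdifferentiableAt_basicFunction {f : M → ℝ} (hf : ContMDiff 𝓘(ℝ, E) 𝓘(ℝ, ℝ) ∞ f)
    (p : DualBundle F A) :
    MDifferentiableAt (dualModel E F) 𝓘(ℝ, ℝ) (basicFunction F A f) p :=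
  (contMDiff_basicFunction hf p).mdifferentiableAt (by simp)

/-- In the trivialization the curve is affine in `t`. Differentiability is what lets the chain rule
be applied to `verticalVec`, as `mfderiv` is zero by default otherwise. -/
theorem mdifferentiableAt_vertical_line (p : DualBundle F A) (θ : DualFiber A p.1) :
    MDifferentiableAt 𝓘(ℝ, ℝ) (dualModel E F)
      (fun t : ℝ => (⟨p.1, p.2 + t • θ⟩ : DualBundle F A)) 0 := by
  refine ContMDiffAt.mdifferentiableAt (n := 1) ?_ (by simp)
  rw [contMDiffAt_totalSpace]
  refine ⟨contMDiffAt_const, ?_⟩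
  have hx := FiberBundle.mem_baseSet_trivializationAt' (F := F) (E := A) p.1
  have : (fun t : ℝ => (trivializationAt (F →L[ℝ] ℝ) (DualFiber A) p.1 ⟨p.1, p.2 + t • θ⟩).2) =
      fun t : ℝ => p.2 ∘L (trivializationAt F A p.1).symmL ℝ p.1 +
        t • (θ ∘L (trivializationAt F A p.1).symmL ℝ p.1) := by
    funext t
    rw [dual_trivializationAt_snd]
    rfl
  simp only
  rw [this]
  exact contMDiffAt_const.add (contMDiffAt_id.smul contMDiffAt_const)

theorem mvfderiv_verticalVec {f : DualBundle F A → ℝ} {p : DualBundle F A}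
    (hf : MDifferentiableAt (dualModel E F) 𝓘(ℝ, ℝ) f p) (θ : DualFiber A p.1) :
    mvfderiv (dualModel E F) f p (verticalVec E p θ) =
      deriv (fun t : ℝ => f ⟨p.1, p.2 + t • θ⟩) 0 := by
  have hp : (⟨p.1, p.2 + (0 : ℝ) • θ⟩ : DualBundle F A) = p := by rw [zero_smul, add_zero]
  have h := mvfderiv_comp_apply_of_eq (I' := 𝓘(ℝ, ℝ)) (I := dualModel E F) (0 : ℝ) hf
    (mdifferentiableAt_vertical_line p θ) hp (1 : ℝ)
  refine h.symm.trans ?_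
  simp only [mvfderiv, mfderiv_eq_fderiv]
  exact fderiv_apply_one_eq_deriv (𝕜 := ℝ) (f := fun t : ℝ => f ⟨p.1, p.2 + t • θ⟩)

@[simp] theorem mvfderiv_linearFunction_verticalVec (μ : GlobalSections E F A) (p : DualBundle F A)
    (θ : DualFiber A p.1) :
    mvfderiv (dualModel E F) (linearFunction μ) p (verticalVec E p θ) = θ (μ p.1) := by
  rw [mvfderiv_verticalVec (mdifferentiableAt_linearFunction μ p)]
  have h : HasDerivAt (fun t : ℝ => p.2 (μ p.1) + t * θ (μ p.1)) (θ (μ p.1)) 0 := by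
    simpa using ((hasDerivAt_id (0 : ℝ)).mul_const (θ (μ p.1))).const_add (p.2 (μ p.1))
  simp only [linearFunction, add_apply, smul_apply, smul_eq_mul]
  exact h.deriv

@[simp] theorem mvfderiv_basicFunction_verticalVec {f : M → ℝ} (hf : ContMDiff 𝓘(ℝ, E) 𝓘(ℝ, ℝ) ∞ f)
    (p : DualBundle F A)
    (θ : DualFiber A p.1) :
    mvfderiv (dualModel E F) (basicFunction F A f) p (verticalVec E p θ) = 0 := by
  rw [mvfderiv_verticalVec (mdifferentiableAt_basicFunction hf p)]
  simp [basicFunction]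

theorem mvfderiv_coordVec {f : DualBundle F A → ℝ} {p : DualBundle F A}
    (hf : MDifferentiableAt (dualModel E F) 𝓘(ℝ, ℝ) f p) (v : TangentSpace 𝓘(ℝ, E) p.1) :
    mvfderiv (dualModel E F) f p (coordVec p v) =
      mvfderiv 𝓘(ℝ, E) (fun y => f ⟨y, FiberBundle.extend (F →L[ℝ] ℝ) p.2 y⟩) p.1 v := by
  have hp : (⟨p.1, FiberBundle.extend (F →L[ℝ] ℝ) p.2 p.1⟩ : DualBundle F A) = p := by
    rw [FiberBundle.extend_apply_self]
  have hs : MDifferentiableAt 𝓘(ℝ, E) (dualModel E F) (fun y : M =>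
      (⟨y, FiberBundle.extend (F →L[ℝ] ℝ) p.2 y⟩ : DualBundle F A)) p.1 :=
    (FiberBundle.contMDiffAt_extend 𝓘(ℝ, E) (F →L[ℝ] ℝ) (k := 1) p.2).mdifferentiableAt (by simp)
  exact (mvfderiv_comp_apply_of_eq (I' := 𝓘(ℝ, E)) (I := dualModel E F) p.1 hf hs hp v).symm

@[simp] theorem mvfderiv_basicFunction_coordVec {f : M → ℝ} (hf : ContMDiff 𝓘(ℝ, E) 𝓘(ℝ, ℝ) ∞ f)
    (p : DualBundle F A)
    (v : TangentSpace 𝓘(ℝ, E) p.1) :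
    mvfderiv (dualModel E F) (basicFunction F A f) p (coordVec p v) = mvfderiv 𝓘(ℝ, E) f p.1 v := by
  rw [mvfderiv_coordVec (mdifferentiableAt_basicFunction hf p)]
  rfl

/-- The function `φ(μ)` on the base. -/
def dualApply (φ : DualSections E F A) (μ : GlobalSections E F A) : C^∞⟮𝓘(ℝ, E), M; ℝ⟯ :=
  ⟨fun x => φ x (μ x), contMDiff_dualSection_apply φ μ⟩

theorem along_neg_verticalLift_linear (φ : DualSections E F A) (μ : GlobalSections E F A) :
    along (dualModel E F) (fun p => -verticalLift φ p) (linearFunction μ) =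
      -basicFunction F A (dualApply φ μ) := by
  funext p
  simp only [along, verticalLift, map_neg, mvfderiv_linearFunction_verticalVec]
  rfl

theorem along_neg_verticalLift_basic (φ : DualSections E F A)
    (f : C^∞⟮𝓘(ℝ, E), M; ℝ⟯) :
    along (dualModel E F) (fun p => -verticalLift φ p) (basicFunction F A f) = 0 := by
  funext p
  simp only [along, verticalLift, map_neg, mvfderiv_basicFunction_verticalVec f.contMDiff]
  simp

variable (E F A) in
/-- The linear and the basic functions on the dual bundle. -/
def generatorFunctions : Set (DualBundle F A → ℝ) :=
  {f | (∃ μ : GlobalSections E F A, f = linearFunction μ) ∨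
    ∃ g : C^∞⟮𝓘(ℝ, E), M; ℝ⟯, f = basicFunction F A g}

theorem contMDiff_along_generators (φ : DualSections E F A) : ∀ f ∈ generatorFunctions E F A,
    ContMDiff (dualModel E F) 𝓘(ℝ, ℝ) ∞
      (along (dualModel E F) (fun p => -verticalLift φ p) f) := by
  rintro _ (⟨μ, rfl⟩ | ⟨f, rfl⟩)
  · rw [along_neg_verticalLift_linear]
    exact (contMDiff_basicFunction (ContMDiffMap.contMDiff _)).neg
  · rw [along_neg_verticalLift_basic]
    exact contMDiff_const

variable [FiniteDimensional ℝ E] [T2Space M] [IsManifold 𝓘(ℝ, E) ∞ M]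
  [ContMDiffVectorBundle ∞ F A 𝓘(ℝ, E)]

theorem frameSection_eventuallyEq (x : M) (u : F) :
    ∀ᶠ y in 𝓝 x, frameSection E A x u y = (trivializationAt F A x).symm y u :=
  (exists_frameSection E A x u).choose_spec

theorem frameSection_self (x : M) (u : F) :
    frameSection E A x u x = (trivializationAt F A x).symm x u :=
  (frameSection_eventuallyEq x u).self_of_nhds

/-- The extension of `p` is a constant covector, and the frame section a constant vector, in the
trivializations around the same point; their pairing is locally the constant `w u`. -/
theorem mvfderiv_linearFunction_frameSection_coordVec (p : DualBundle F A) (u : F)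
    (v : TangentSpace 𝓘(ℝ, E) p.1) :
    mvfderiv (dualModel E F) (linearFunction (frameSection E A p.1 u)) p (coordVec p v) = 0 := by
  rw [mvfderiv_coordVec (mdifferentiableAt_linearFunction _ p)]
  set w := (trivializationAt (F →L[ℝ] ℝ) (DualFiber A) p.1 ⟨p.1, p.2⟩).2 with hw
  have hev : (fun y => linearFunction (frameSection E A p.1 u)
      ⟨y, FiberBundle.extend (F →L[ℝ] ℝ) p.2 y⟩) =ᶠ[𝓝 p.1] fun _ => w u := by
    have hb := (trivializationAt F A p.1).open_baseSet.mem_nhds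
      (FiberBundle.mem_baseSet_trivializationAt' p.1)
    filter_upwards [frameSection_eventuallyEq (E := E) (A := A) p.1 u, hb] with y hy hyb
    have h1 : FiberBundle.extend (F →L[ℝ] ℝ) p.2 y =
        w ∘L (trivializationAt F A p.1).continuousLinearMapAt ℝ y := by
      rw [← dual_symmL hyb, Trivialization.symmL_apply]
      · rfl
      · exact mem_baseSet_dual_trivializationAt hyb
    simp only [linearFunction, hy, h1]
    simp [hyb]
  rw [mvfderiv_congr_of_eventuallyEq hev, mvfderiv_const]
  rfl

/-- A functional on `E × F*` splits into a functional `β` on `E` and one on `F*`, and the latter is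
evaluation at some `u : F`. The first part gives a basic function, made global by a bump function;
the second gives the linear function of the frame section of `u`. -/
theorem generatesCoordinates_generatorFunctions [FiniteDimensional ℝ F] :
    GeneratesCoordinates (dualModel E F) (generatorFunctions E F A) where
  contMDiff := by
    rintro f (⟨μ, rfl⟩ | ⟨g, rfl⟩)
    · exact contMDiff_linearFunction μ
    · exact contMDiff_basicFunction g.contMDiff
  exists_add := by
    intro p α
    obtain ⟨u, hu⟩ := exists_eq_apply_of_dual (V := F)
      (α ∘L ContinuousLinearMap.inr ℝ E (F →L[ℝ] ℝ)).toLinearMap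
    let β : E →L[ℝ] ℝ := α ∘L ContinuousLinearMap.inl ℝ E (F →L[ℝ] ℝ)
    obtain ⟨b⟩ : Nonempty (SmoothBumpFunction 𝓘(ℝ, E) p.1) := inferInstance
    let g : C^∞⟮𝓘(ℝ, E), M; ℝ⟯ := ⟨fun y => b y • β (extChartAt 𝓘(ℝ, E) p.1 y),
      b.contMDiff_smul (β.contMDiff.comp_contMDiffOn contMDiffOn_extChartAt)⟩
    refine ⟨basicFunction F A g, Or.inr ⟨g, rfl⟩, linearFunction (frameSection E A p.1 u),
      Or.inl ⟨_, rfl⟩, ?_⟩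
    have hc : Filter.Tendsto (fun q : DualBundle F A => q.1) (𝓝 p) (𝓝 p.1) :=
      (FiberBundle.continuous_proj (F →L[ℝ] ℝ) (DualFiber A)).continuousAt
    have hb := (trivializationAt F A p.1).open_baseSet.mem_nhds
      (FiberBundle.mem_baseSet_trivializationAt' p.1)
    filter_upwards [hc.eventually b.eventuallyEq_one, hc.eventually hb,
      hc.eventually (frameSection_eventuallyEq (E := E) (A := A) p.1 u)] with q h1 h2 h3
    have h4 : extChartAt (dualModel E F) p q = (extChartAt 𝓘(ℝ, E) p.1 q.1,
        q.2 ∘L (trivializationAt F A p.1).symmL ℝ q.1) := by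
      rw [← dual_trivializationAt_snd, FiberBundle.extChartAt]
      simp only [PartialEquiv.trans_apply, PartialEquiv.prod_coe, PartialEquiv.refl_coe, id]
      rw [OpenPartialHomeomorph.toFun_eq_coe, Trivialization.coe_coe,
        Trivialization.coe_fst' _ (mem_baseSet_dual_trivializationAt h2)]
    have h5 := hu (q.2 ∘L (trivializationAt F A p.1).symmL ℝ q.1)
    have h6 : ∀ z : E × (F →L[ℝ] ℝ), α z = β z.1 +
        (α ∘L ContinuousLinearMap.inr ℝ E (F →L[ℝ] ℝ)).toLinearMap z.2 := by
      intro z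
      simp [β, ← map_add]
    have h7 : g q.1 = β (extChartAt 𝓘(ℝ, E) p.1 q.1) := by
      have : b q.1 = 1 := h1
      simp [g, this]
    rw [h4, h6, ← h5, basicFunction, linearFunction, h3, h7,
      ← Trivialization.symmL_apply (R := ℝ) _ h2]
    rfl

end DualBundle

/-- Evaluates `∑_{i<j} c_ij ∂_i ∧ ∂_j` on a pair of coordinates: for `k < l` the first product
survives, for `l < k` the second, with the sign absorbed by antisymmetry, and `c k k = 0`. -/
theorem sum_Ioi_antisymm {n : ℕ} {c : Fin n → Fin n → ℝ} (hc : ∀ i j, c i j = -c j i)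
    (k l : Fin n) :
    ∑ i, ∑ j ∈ Finset.Ioi i, c i j * ((if i = k then 1 else 0) * (if j = l then 1 else 0) -
      (if j = k then 1 else 0) * (if i = l then 1 else 0)) = c k l := by
  have h : ∀ i, ∑ j ∈ Finset.Ioi i, c i j * ((if i = k then 1 else 0) * (if j = l then 1 else 0) -
      (if j = k then 1 else 0) * (if i = l then 1 else 0)) =
      (if i = k then (if i < l then c i l else 0) else 0) -
      (if i = l then (if i < k then c i k else 0) else 0) := by
    intro i
    simp only [mul_sub, Finset.sum_sub_distrib]
    congr 1
    · by_cases hi : i = k <;> simp [hi]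
    · by_cases hi : i = l <;> simp [hi]
  simp only [h, Finset.sum_sub_distrib, Finset.sum_ite_eq', Finset.mem_univ, if_true]
  rcases lt_trichotomy k l with hkl | rfl | hkl
  · simp [hkl, hkl.not_gt]
  · have := hc k k
    simp; linarith
  · simp [hkl, hkl.not_gt, hc k l]

/-! ### Product rules and cyclic symmetry -/

section Derivations

variable {E : Type*} [NormedAddCommGroup E] [NormedSpace ℝ E]
  {H : Type*} [TopologicalSpace H] {I : ModelWithCorners ℝ E H}
  {N : Type*} [TopologicalSpace N] [ChartedSpace H N]

theorem wedgeVec_apply {x : N} (X Y : TangentSpace I x) (α β : Cotangent I x) :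
    wedgeVec I X Y α β = α X * β Y - α Y * β X := rfl

variable {X : ∀ x : N, TangentSpace I x} {Λ : ∀ x : N, CotangentForm I x} {f g h : N → ℝ} {x : N}

theorem pairing_mul_left (hf : MDifferentiableAt I 𝓘(ℝ, ℝ) f x)
    (hg : MDifferentiableAt I 𝓘(ℝ, ℝ) g x) :
    pairing I Λ (f * g) h x = f x * pairing I Λ g h x + g x * pairing I Λ f h x := by
  simp [pairing, mvfderiv_mul hf hg]

theorem pairing_add_left (hf : MDifferentiableAt I 𝓘(ℝ, ℝ) f x)
    (hg : MDifferentiableAt I 𝓘(ℝ, ℝ) g x) :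
    pairing I Λ (f + g) h x = pairing I Λ f h x + pairing I Λ g h x := by
  simp [pairing, mvfderiv_add hf hg]

theorem pairing_sub_left (hf : MDifferentiableAt I 𝓘(ℝ, ℝ) f x)
    (hg : MDifferentiableAt I 𝓘(ℝ, ℝ) g x) :
    pairing I Λ (f - g) h x = pairing I Λ f h x - pairing I Λ g h x := by
  simp [pairing, mvfderiv_sub hf hg]

theorem pairing_neg_left : pairing I Λ (-f) h x = -pairing I Λ f h x := by
  simp [pairing]

theorem pairing_const_left (c : ℝ) : pairing I Λ (fun _ => c) h x = 0 := by
  simp [pairing, mvfderiv_const]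

theorem along_mul (hf : MDifferentiableAt I 𝓘(ℝ, ℝ) f x) (hg : MDifferentiableAt I 𝓘(ℝ, ℝ) g x) :
    along I X (f * g) x = f x * along I X g x + g x * along I X f x := by
  simp [along, mvfderiv_mul hf hg]

theorem along_add (hf : MDifferentiableAt I 𝓘(ℝ, ℝ) f x) (hg : MDifferentiableAt I 𝓘(ℝ, ℝ) g x) :
    along I X (f + g) x = along I X f x + along I X g x := by
  simp [along, mvfderiv_add hf hg]

theorem along_sub (hf : MDifferentiableAt I 𝓘(ℝ, ℝ) f x) (hg : MDifferentiableAt I 𝓘(ℝ, ℝ) g x) :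
    along I X (f - g) x = along I X f x - along I X g x := by
  simp [along, mvfderiv_sub hf hg]

theorem along_neg : along I X (-f) x = -along I X f x := by
  simp [along]

theorem along_zero : along I X 0 x = 0 := by
  simp [along]

theorem pairing_zero_left : pairing I Λ 0 h x = 0 := by
  simp [pairing]

theorem schoutenBivec_cyclic :
    schoutenBivec I Λ Λ f g h x = schoutenBivec I Λ Λ g h f x := by
  simp only [schoutenBivec, Pi.add_apply]
  ring

theorem wedgeVecBivec_cyclic (v : TangentSpace I x) (P : CotangentForm I x)
    (α β γ : Cotangent I x) : wedgeVecBivec I v P α β γ = wedgeVecBivec I v P β γ α := by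
  simp only [wedgeVecBivec]
  ring

end Derivations

/-! ### Local frames and tensorial forms on sections -/

section Frames

variable {E : Type*} [NormedAddCommGroup E] [NormedSpace ℝ E] [FiniteDimensional ℝ E]
  {M : Type*} [TopologicalSpace M] [ChartedSpace E M] [T2Space M] [IsManifold 𝓘(ℝ, E) ∞ M]
  {F : Type*} [NormedAddCommGroup F] [NormedSpace ℝ F] [FiniteDimensional ℝ F]
  {A : M → Type*} [∀ x, AddCommGroup (A x)] [∀ x, Module ℝ (A x)] [∀ x, TopologicalSpace (A x)]
  [TopologicalSpace (TotalSpace F A)] [FiberBundle F A] [VectorBundle ℝ F A]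
  [ContMDiffVectorBundle ∞ F A 𝓘(ℝ, E)]

theorem sum_dualFrame_smul_frameSection (x : M) (a : A x) :
    ∑ i, dualFrame A x i a • frameSection E A x (Module.finBasis ℝ F i) x = a := by
  have hx := FiberBundle.mem_baseSet_trivializationAt' (F := F) (E := A) x
  have h1 := (trivializationAt F A x).symmL_continuousLinearMapAt (R := ℝ) hx a
  rw [← (Module.finBasis ℝ F).sum_repr ((trivializationAt F A x).continuousLinearMapAt ℝ x a),
    map_sum] at h1
  refine Eq.trans (Finset.sum_congr rfl fun i _ => ?_) h1
  rw [map_smul, frameSection_self, Trivialization.symmL_apply _ hx]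
  rfl

theorem dualFrame_frameSection (x : M) (i j : Fin (Module.finrank ℝ F)) :
    dualFrame A x i (frameSection E A x (Module.finBasis ℝ F j) x) = if i = j then 1 else 0 := by
  have hx := FiberBundle.mem_baseSet_trivializationAt' (F := F) (E := A) x
  rw [frameSection_self, ← Trivialization.symmL_apply (R := ℝ) _ hx, dualFrame,
    ContinuousLinearMap.comp_apply, Trivialization.continuousLinearMapAt_symmL _ hx]
  simp [Finsupp.single_apply, eq_comm]

/-- The frame spans only near `x`. Multiplying by a bump function supported there makes the
expansion an identity of global sections, so it can be fed to operators on `Γ(A)` without first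
proving them local. -/
theorem exists_smulSection_eq_sum (x : M) (η : GlobalSections E F A) :
    ∃ (c : C^∞⟮𝓘(ℝ, E), M; ℝ⟯) (f : Fin (Module.finrank ℝ F) → C^∞⟮𝓘(ℝ, E), M; ℝ⟯), c x = 1 ∧
      smulSection c η = ∑ i, smulSection (f i) (frameSection E A x (Module.finBasis ℝ F i)) := by
  set t := trivializationAt F A x
  have hU : {y | y ∈ t.baseSet ∧ ∀ i, frameSection E A x (Module.finBasis ℝ F i) y =
      t.symm y (Module.finBasis ℝ F i)} ∈ 𝓝 x :=
    (t.open_baseSet.eventually_mem (FiberBundle.mem_baseSet_trivializationAt' x)).and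
      (Filter.eventually_all.2 fun i => frameSection_eventuallyEq x _)
  obtain ⟨b, -, hb⟩ := (SmoothBumpFunction.nhds_basis_tsupport (I := 𝓘(ℝ, E)) x).mem_iff.1 hU
  let f (i : Fin (Module.finrank ℝ F)) (y : M) : ℝ :=
    b y • ((Module.finBasis ℝ F).coord i).toContinuousLinearMap (t ⟨y, η y⟩).2
  have hf : ∀ i, ContMDiff 𝓘(ℝ, E) 𝓘(ℝ, ℝ) ∞ (f i) := by
    intro i
    -- Smoothness has to be checked only on the support, which lies inside the base set of the
    -- trivialization.
    refine contMDiff_of_tsupport fun y hy => ?_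
    have hy' : y ∈ t.baseSet := (hb (tsupport_smul_subset_left _ _ hy)).1
    refine b.contMDiffAt.smul ?_
    exact (ContinuousLinearMap.contMDiff _).contMDiffAt.comp y
      ((t.contMDiffAt_section_iff hy').1 η.contMDiff.contMDiffAt)
  refine ⟨⟨b, b.contMDiff⟩, fun i => ⟨f i, hf i⟩, b.eq_one, ?_⟩
  ext y
  have hsum : ∀ s : Fin (Module.finrank ℝ F) → GlobalSections E F A, (∑ i, s i) y = ∑ i, s i y :=
    fun s => (congrFun (map_sum (ContMDiffSection.coeAddHom 𝓘(ℝ, E) F ∞ A) s Finset.univ) y).trans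
      (Finset.sum_apply _ _ _)
  rw [hsum]
  change b y • η y = ∑ i, f i y • frameSection E A x (Module.finBasis ℝ F i) y
  by_cases hy : b y = 0
  · simp [f, hy]
  · obtain ⟨hy1, hy2⟩ := hb (subset_tsupport _ hy)
    have h1 := t.symmL_continuousLinearMapAt (R := ℝ) hy1 (η y)
    rw [← (Module.finBasis ℝ F).sum_repr (t.continuousLinearMapAt ℝ y (η y)),
      map_sum] at h1
    conv_lhs => rw [← h1]
    rw [Finset.smul_sum]
    refine Finset.sum_congr rfl fun i _ => ?_
    rw [map_smul, hy2, Trivialization.symmL_apply _ hy1, smul_smul]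
    simp [f, t.coe_linearMapAt_of_mem hy1]

/-- A linear form on sections that is tensorial at `x` vanishes if it vanishes on a local frame. -/
theorem eq_zero_of_tensorial {x : M} {D : GlobalSections E F A →ₗ[ℝ] ℝ}
    (hD : ∀ (f : C^∞⟮𝓘(ℝ, E), M; ℝ⟯) (η : GlobalSections E F A), D (smulSection f η) = f x * D η)
    (h : ∀ i, D (frameSection E A x (Module.finBasis ℝ F i)) = 0) (η : GlobalSections E F A) :
    D η = 0 := by
  obtain ⟨c, f, hc, e⟩ := exists_smulSection_eq_sum x η
  have h1 := congrArg D e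
  rwa [hD, hc, one_mul, map_sum, Finset.sum_eq_zero fun i _ => by rw [hD, h, mul_zero]] at h1

end Frames

/-! ### The linear Poisson bivector on generators -/

section Algebroid

variable {E : Type*} [NormedAddCommGroup E] [NormedSpace ℝ E]
  {M : Type*} [TopologicalSpace M] [ChartedSpace E M]
  {F : Type*} [NormedAddCommGroup F] [NormedSpace ℝ F]
  {A : M → Type*} [∀ x, AddCommGroup (A x)] [∀ x, Module ℝ (A x)] [∀ x, TopologicalSpace (A x)]
  [TopologicalSpace (TotalSpace F A)] [FiberBundle F A] [VectorBundle ℝ F A]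

theorem linearFunction_add (μ η : GlobalSections E F A) :
    linearFunction (μ + η) = linearFunction μ + linearFunction η :=
  funext fun p => map_add p.2 _ _

theorem linearFunction_smul (c : ℝ) (μ : GlobalSections E F A) :
    linearFunction (c • μ) = (fun _ => c) * linearFunction μ :=
  funext fun p => map_smul p.2 _ _

theorem linearFunction_smulSection (f : C^∞⟮𝓘(ℝ, E), M; ℝ⟯) (μ : GlobalSections E F A) :
    linearFunction (smulSection f μ) = basicFunction F A f * linearFunction μ :=
  funext fun p => map_smul p.2 (f p.1) (μ p.1)

namespace LieAlgebroid

variable [IsManifold 𝓘(ℝ, E) ∞ M] (L : LieAlgebroid E F A)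

theorem bracket_swap (μ η : GlobalSections E F A) : L.bracket μ η = -L.bracket η μ := by
  have h := L.bracket_self (μ + η)
  simp only [map_add, LinearMap.add_apply, L.bracket_self, zero_add, add_zero] at h
  rw [add_comm] at h
  exact eq_neg_of_add_eq_zero_left h

/-- The derivative `ρ(μ)(f)` of a function on the base along the anchor of a section. -/
def anchorDeriv (μ : GlobalSections E F A) (f : M → ℝ) : M → ℝ :=
  along 𝓘(ℝ, E) (fun y => L.anchor y (μ y)) f

theorem contMDiff_anchor (μ : GlobalSections E F A) : ContMDiff 𝓘(ℝ, E) 𝓘(ℝ, E).tangent ∞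
    (fun y => (⟨y, L.anchor y (μ y)⟩ : TangentBundle 𝓘(ℝ, E) M)) :=
  L.anchor_smooth.comp μ.contMDiff

theorem contMDiff_anchorDeriv (μ : GlobalSections E F A) {f : M → ℝ}
    (hf : ContMDiff 𝓘(ℝ, E) 𝓘(ℝ, ℝ) ∞ f) : ContMDiff 𝓘(ℝ, E) 𝓘(ℝ, ℝ) ∞ (L.anchorDeriv μ f) :=
  (L.contMDiff_anchor μ).along hf

theorem anchorDeriv_bracket [FiniteDimensional ℝ E] (μ η : GlobalSections E F A) {f : M → ℝ}
    (hf : ContMDiff 𝓘(ℝ, E) 𝓘(ℝ, ℝ) ∞ f) (x : M) :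
    L.anchorDeriv (L.bracket μ η) f x =
      L.anchorDeriv μ (L.anchorDeriv η f) x - L.anchorDeriv η (L.anchorDeriv μ f) x := by
  have h := along_commutator (L.contMDiff_anchor μ) (L.contMDiff_anchor η) hf x
  rw [← L.anchor_bracket] at h
  exact h.symm

/-- The function `ρ(μ)(f)` on the base. -/
def anchorApply (μ : GlobalSections E F A) (f : C^∞⟮𝓘(ℝ, E), M; ℝ⟯) : C^∞⟮𝓘(ℝ, E), M; ℝ⟯ :=
  ⟨L.anchorDeriv μ f, L.contMDiff_anchorDeriv μ f.contMDiff⟩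

theorem IsCocycle.apply_bracket {L : LieAlgebroid E F A} {φ : DualSections E F A}
    (hφ : L.IsCocycle φ) (μ η : GlobalSections E F A) (x : M) :
    dualApply φ (L.bracket μ η) x =
      L.anchorApply μ (dualApply φ η) x - L.anchorApply η (dualApply φ μ) x :=
  hφ μ η x

variable [FiniteDimensional ℝ E] [T2Space M] [FiniteDimensional ℝ F]
  [ContMDiffVectorBundle ∞ F A 𝓘(ℝ, E)]

theorem linearPoisson_apply (p : DualBundle F A) (α β : Cotangent (dualModel E F) p) :
    L.linearPoisson p α β =
      ∑ i, ∑ j ∈ Finset.Ioi i, p.2 (L.bracket (frameSection E A p.1 (Module.finBasis ℝ F i))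
          (frameSection E A p.1 (Module.finBasis ℝ F j)) p.1) *
        wedgeVec (dualModel E F) (verticalVec E p (dualFrame A p.1 i))
          (verticalVec E p (dualFrame A p.1 j)) α β +
      ∑ i, wedgeVec (dualModel E F) (verticalVec E p (dualFrame A p.1 i))
        (coordVec p (L.anchor p.1 (frameSection E A p.1 (Module.finBasis ℝ F i) p.1))) α β := by
  simp only [linearPoisson, add_apply, sum_apply, smul_apply, smul_eq_mul]

theorem linearPoisson_self (p : DualBundle F A) (α : Cotangent (dualModel E F) p) :
    L.linearPoisson p α α = 0 := by
  simp [linearPoisson_apply, wedgeVec_apply, mul_comm]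

theorem linearPoisson_basic_basic {f g : M → ℝ} (hf : ContMDiff 𝓘(ℝ, E) 𝓘(ℝ, ℝ) ∞ f)
    (hg : ContMDiff 𝓘(ℝ, E) 𝓘(ℝ, ℝ) ∞ g) :
    pairing (dualModel E F) L.linearPoisson (basicFunction F A f) (basicFunction F A g) = 0 := by
  funext p
  simp [pairing, linearPoisson_apply, wedgeVec_apply, mvfderiv_basicFunction_verticalVec hf,
    mvfderiv_basicFunction_verticalVec hg]

/-- Vertical vectors kill `f ∘ π*`, so only the terms with the anchor survive, and `∑ e^i(μ) ρ(e_i)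
= ρ(μ)`. -/
theorem linearPoisson_linear_basic (μ : GlobalSections E F A) {f : M → ℝ}
    (hf : ContMDiff 𝓘(ℝ, E) 𝓘(ℝ, ℝ) ∞ f) :
    pairing (dualModel E F) L.linearPoisson (linearFunction μ) (basicFunction F A f) =
      basicFunction F A (L.anchorDeriv μ f) := by
  funext p
  have h := sum_dualFrame_smul_frameSection (E := E) (F := F) p.1 (μ p.1)
  simp only [pairing, linearPoisson_apply, wedgeVec_apply, mvfderiv_basicFunction_verticalVec hf,
    mvfderiv_basicFunction_coordVec hf, mvfderiv_linearFunction_verticalVec, mul_zero, sub_zero,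
    Finset.sum_const_zero, zero_add]
  change _ = mvfderiv 𝓘(ℝ, E) f p.1 (L.anchor p.1 (μ p.1))
  conv_rhs => rw [← h, map_sum, map_sum]
  simp only [map_smul, smul_eq_mul]

theorem linearPoisson_frame_frame (p : DualBundle F A) (k l : Fin (Module.finrank ℝ F)) :
    pairing (dualModel E F) L.linearPoisson
      (linearFunction (frameSection E A p.1 (Module.finBasis ℝ F k)))
      (linearFunction (frameSection E A p.1 (Module.finBasis ℝ F l))) p =
    p.2 (L.bracket (frameSection E A p.1 (Module.finBasis ℝ F k))
      (frameSection E A p.1 (Module.finBasis ℝ F l)) p.1) := by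
  have hc : ∀ i j, p.2 (L.bracket (frameSection E A p.1 (Module.finBasis ℝ F i))
      (frameSection E A p.1 (Module.finBasis ℝ F j)) p.1) =
      -p.2 (L.bracket (frameSection E A p.1 (Module.finBasis ℝ F j))
      (frameSection E A p.1 (Module.finBasis ℝ F i)) p.1) := by
    intro i j
    rw [L.bracket_swap, ContMDiffSection.coe_neg, Pi.neg_apply, map_neg]
  refine Eq.trans ?_ (sum_Ioi_antisymm hc k l)
  simp only [pairing, linearPoisson_apply, wedgeVec_apply, mvfderiv_linearFunction_verticalVec,
    mvfderiv_linearFunction_frameSection_coordVec, dualFrame_frameSection, mul_zero, zero_mul,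
    sub_zero, Finset.sum_const_zero, add_zero]

/-- Both sides obey the same Leibniz rule, with the same derivative term by
`linearPoisson_linear_basic`. Their difference at `p` is thus tensorial, and
`linearPoisson_frame_frame` shows that it vanishes on the frame. -/
theorem linearPoisson_linear_linear (μ η : GlobalSections E F A) :
    pairing (dualModel E F) L.linearPoisson (linearFunction μ) (linearFunction η) =
      linearFunction (L.bracket μ η) := by
  funext p
  have hswap := fun f g => congrFun (pairing_swap L.linearPoisson_self f g) p
  simp only [Pi.neg_apply] at hswap
  have hd := fun μ : GlobalSections E F A => mdifferentiableAt_linearFunction μ p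
  let D (μ : GlobalSections E F A) : GlobalSections E F A →ₗ[ℝ] ℝ :=
    { toFun := fun η =>
        pairing (dualModel E F) L.linearPoisson (linearFunction η) (linearFunction μ) p -
          p.2 (L.bracket η μ p.1)
      map_add' := fun η ν => by
        rw [linearFunction_add, pairing_add_left (hd η) (hd ν), map_add, LinearMap.add_apply,
          ContMDiffSection.coe_add, Pi.add_apply, map_add]
        ring
      map_smul' := fun c η => by
        rw [linearFunction_smul, pairing_mul_left mdifferentiableAt_const (hd η), map_smul,
          LinearMap.smul_apply, ContMDiffSection.coe_smul, Pi.smul_apply, map_smul]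
        simp only [pairing_const_left, smul_eq_mul, RingHom.id_apply]
        ring }
  have hDswap : ∀ μ η, D μ η = -D η μ := by
    intro μ η
    change pairing (dualModel E F) L.linearPoisson (linearFunction η) (linearFunction μ) p -
          p.2 (L.bracket η μ p.1) =
      -(pairing (dualModel E F) L.linearPoisson (linearFunction μ) (linearFunction η) p -
          p.2 (L.bracket μ η p.1))
    rw [hswap, L.bracket_swap η μ, ContMDiffSection.coe_neg, Pi.neg_apply, map_neg]
    ring
  have hDsmul : ∀ μ (f : C^∞⟮𝓘(ℝ, E), M; ℝ⟯) η, D μ (smulSection f η) = f p.1 * D μ η := by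
    intro μ f η
    have hb := congrFun (L.linearPoisson_linear_basic μ f.contMDiff) p
    change pairing (dualModel E F) L.linearPoisson (linearFunction (smulSection f η))
        (linearFunction μ) p - p.2 (L.bracket (smulSection f η) μ p.1) = f p.1 *
      (pairing (dualModel E F) L.linearPoisson (linearFunction η) (linearFunction μ) p -
          p.2 (L.bracket η μ p.1))
    rw [linearFunction_smulSection,
      pairing_mul_left (mdifferentiableAt_basicFunction f.contMDiff p) (hd η),
      hswap (basicFunction F A f), hb, L.bracket_swap (smulSection f η), L.bracket_swap η,
      ContMDiffSection.coe_neg, ContMDiffSection.coe_neg, Pi.neg_apply, Pi.neg_apply, L.leibniz,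
      map_neg, map_neg, map_add, map_smul, map_smul]
    simp only [basicFunction, linearFunction, anchorDeriv, along, smul_eq_mul]
    ring
  -- The second argument of `D` is freed first, against frame sections; antisymmetry then frees the
  -- other.
  have h1 : ∀ k η, D (frameSection E A p.1 (Module.finBasis ℝ F k)) η = 0 := fun k =>
    eq_zero_of_tensorial (hDsmul _) fun i => sub_eq_zero.2 (L.linearPoisson_frame_frame p i k)
  have h2 : D η μ = 0 := eq_zero_of_tensorial (hDsmul η) (fun i => by
    rw [hDswap, h1, neg_zero]) μ
  exact sub_eq_zero.1 h2

end LieAlgebroid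
end Algebroid

/-! ### The Jacobi structure: existence and uniqueness -/

section AlgebroidJacobi

variable {E : Type*} [NormedAddCommGroup E] [NormedSpace ℝ E] [FiniteDimensional ℝ E]
  {M : Type*} [TopologicalSpace M] [ChartedSpace E M] [T2Space M] [IsManifold 𝓘(ℝ, E) ∞ M]
  {F : Type*} [NormedAddCommGroup F] [NormedSpace ℝ F] [FiniteDimensional ℝ F]
  {A : M → Type*} [∀ x, AddCommGroup (A x)] [∀ x, Module ℝ (A x)] [∀ x, TopologicalSpace (A x)]
  [TopologicalSpace (TotalSpace F A)] [FiberBundle F A] [VectorBundle ℝ F A]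
  [ContMDiffVectorBundle ∞ F A 𝓘(ℝ, E)]

namespace LieAlgebroid

variable (L : LieAlgebroid E F A) (φ : DualSections E F A)

/-- The bivector field `Λ_{A*} + Δ ∧ φ^v`. -/
def jacobiBivec (p : DualBundle F A) : CotangentForm (dualModel E F) p :=
  L.linearPoisson p + wedgeVec (dualModel E F) (liouville p) (verticalLift φ p)

theorem jacobiBivec_self (p : DualBundle F A) (α : Cotangent (dualModel E F) p) :
    L.jacobiBivec φ p α α = 0 := by
  simp only [jacobiBivec, add_apply, linearPoisson_self, wedgeVec_apply]
  ring

theorem pairing_jacobiBivec (f g : DualBundle F A → ℝ) (p : DualBundle F A) :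
    pairing (dualModel E F) (L.jacobiBivec φ) f g p =
      pairing (dualModel E F) L.linearPoisson f g p +
        (mvfderiv (dualModel E F) f p (liouville p) *
          mvfderiv (dualModel E F) g p (verticalLift φ p) -
        mvfderiv (dualModel E F) f p (verticalLift φ p) *
          mvfderiv (dualModel E F) g p (liouville p)) := rfl

theorem jacobiBivec_linear_linear (μ η : GlobalSections E F A) :
    pairing (dualModel E F) (L.jacobiBivec φ) (linearFunction μ) (linearFunction η) =
      linearFunction (L.bracket μ η) + linearFunction μ * basicFunction F A (dualApply φ η) -
        basicFunction F A (dualApply φ μ) * linearFunction η := by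
  funext p
  rw [pairing_jacobiBivec, linearPoisson_linear_linear]
  simp only [liouville, verticalLift, mvfderiv_linearFunction_verticalVec, Pi.add_apply,
    Pi.sub_apply, Pi.mul_apply]
  rw [add_sub_assoc]
  rfl

theorem jacobiBivec_linear_basic (μ : GlobalSections E F A) (f : C^∞⟮𝓘(ℝ, E), M; ℝ⟯) :
    pairing (dualModel E F) (L.jacobiBivec φ) (linearFunction μ) (basicFunction F A f) =
      basicFunction F A (L.anchorApply μ f) := by
  funext p
  rw [pairing_jacobiBivec, linearPoisson_linear_basic _ _ f.contMDiff]
  simp only [liouville, verticalLift, mvfderiv_basicFunction_verticalVec f.contMDiff, mul_zero,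
    sub_zero, add_zero]
  rfl

theorem jacobiBivec_basic_linear (μ : GlobalSections E F A) (f : C^∞⟮𝓘(ℝ, E), M; ℝ⟯) :
    pairing (dualModel E F) (L.jacobiBivec φ) (basicFunction F A f) (linearFunction μ) =
      -basicFunction F A (L.anchorApply μ f) := by
  rw [pairing_swap (L.jacobiBivec_self φ), jacobiBivec_linear_basic]

theorem jacobiBivec_basic_basic (f g : C^∞⟮𝓘(ℝ, E), M; ℝ⟯) :
    pairing (dualModel E F) (L.jacobiBivec φ) (basicFunction F A f) (basicFunction F A g) = 0 := by
  funext p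
  rw [pairing_jacobiBivec, linearPoisson_basic_basic _ f.contMDiff g.contMDiff]
  simp only [liouville, verticalLift, mvfderiv_basicFunction_verticalVec f.contMDiff,
    mvfderiv_basicFunction_verticalVec g.contMDiff, mul_zero, sub_zero, add_zero]

theorem contMDiff_pairing_generators : ∀ f ∈ generatorFunctions E F A,
    ∀ g ∈ generatorFunctions E F A,
    ContMDiff (dualModel E F) 𝓘(ℝ, ℝ) ∞ (pairing (dualModel E F) (L.jacobiBivec φ) f g) := by
  rintro _ (⟨μ, rfl⟩ | ⟨f, rfl⟩) _ (⟨η, rfl⟩ | ⟨g, rfl⟩)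
  · rw [jacobiBivec_linear_linear]
    exact ((contMDiff_linearFunction _).add ((contMDiff_linearFunction _).mul
      (contMDiff_basicFunction (dualApply φ η).contMDiff))).sub
      ((contMDiff_basicFunction (dualApply φ μ).contMDiff).mul (contMDiff_linearFunction _))
  · rw [jacobiBivec_linear_basic]
    exact contMDiff_basicFunction (ContMDiffMap.contMDiff _)
  · rw [jacobiBivec_basic_linear]
    exact (contMDiff_basicFunction (ContMDiffMap.contMDiff _)).neg
  · rw [jacobiBivec_basic_basic]
    exact contMDiff_const

variable {L φ}

/-- On two linear functions the expression is `-φ[[μ, η]] + ρ(μ)(φ(η)) - ρ(η)(φ(μ))`, zero by the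
cocycle condition. In the other cases every term vanishes, because `φ^v` kills basic functions and
these pair to zero. -/
theorem schoutenVecBivec_generators (hφ : L.IsCocycle φ) : ∀ f ∈ generatorFunctions E F A,
    ∀ g ∈ generatorFunctions E F A, ∀ p, schoutenVecBivec (dualModel E F)
      (fun p => -verticalLift φ p) (L.jacobiBivec φ) f g p = 0 := by
  have hl := fun (μ : GlobalSections E F A) p => mdifferentiableAt_linearFunction μ p
  have hb := fun (f : C^∞⟮𝓘(ℝ, E), M; ℝ⟯) (p : DualBundle F A) =>
    mdifferentiableAt_basicFunction f.contMDiff p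
  have el := fun μ p => congrFun (along_neg_verticalLift_linear φ μ) p
  have eb := fun f p => congrFun (along_neg_verticalLift_basic φ f) p
  rintro _ (⟨μ, rfl⟩ | ⟨f, rfl⟩) _ (⟨η, rfl⟩ | ⟨g, rfl⟩) p
  · have hc : L.anchorApply μ (dualApply φ η) p.1 - L.anchorApply η (dualApply φ μ) p.1 =
        dualApply φ (L.bracket μ η) p.1 := (hφ.apply_bracket μ η p.1).symm
    simp only [schoutenVecBivec, Pi.sub_apply]
    rw [jacobiBivec_linear_linear, along_neg_verticalLift_linear, along_neg_verticalLift_linear,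
      along_sub ((hl _ p).add ((hl _ p).mul (hb _ p))) ((hb _ p).mul (hl _ p)),
      along_add (hl _ p) ((hl _ p).mul (hb _ p)), along_mul (hl _ p) (hb _ p),
      along_mul (hb _ p) (hl _ p), pairing_swap (L.jacobiBivec_self φ) (linearFunction μ)]
    simp only [el, eb, pairing_neg_left, jacobiBivec_basic_linear, Pi.neg_apply, Pi.zero_apply,
      basicFunction]
    linarith
  · simp only [schoutenVecBivec, Pi.sub_apply]
    rw [jacobiBivec_linear_basic, along_neg_verticalLift_linear, along_neg_verticalLift_basic,
      along_neg_verticalLift_basic, pairing_neg_left, jacobiBivec_basic_basic,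
      pairing_swap (L.jacobiBivec_self φ) _ 0, Pi.neg_apply, pairing_zero_left]
    simp
  · simp only [schoutenVecBivec, Pi.sub_apply]
    rw [jacobiBivec_basic_linear, along_neg_verticalLift_linear, along_neg_verticalLift_basic,
      pairing_zero_left, pairing_swap (L.jacobiBivec_self φ) _ (-_), Pi.neg_apply,
      pairing_neg_left, jacobiBivec_basic_basic, along_neg, along_neg_verticalLift_basic]
    simp
  · simp only [schoutenVecBivec, Pi.sub_apply]
    rw [jacobiBivec_basic_basic, along_neg_verticalLift_basic, along_neg_verticalLift_basic,
      pairing_zero_left, pairing_swap (L.jacobiBivec_self φ) _ 0, Pi.neg_apply,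
      pairing_zero_left, along_zero]
    simp

theorem wedgeVecBivec_neg_verticalLift (f g h : DualBundle F A → ℝ) (p : DualBundle F A) :
    wedgeVecBivec (dualModel E F) (-verticalLift φ p) (L.jacobiBivec φ p)
        (mvfderiv (dualModel E F) f p) (mvfderiv (dualModel E F) g p)
        (mvfderiv (dualModel E F) h p) =
      along (dualModel E F) (fun p => -verticalLift φ p) f p *
          pairing (dualModel E F) (L.jacobiBivec φ) g h p +
        along (dualModel E F) (fun p => -verticalLift φ p) g p *
          pairing (dualModel E F) (L.jacobiBivec φ) h f p +
        along (dualModel E F) (fun p => -verticalLift φ p) h p *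
          pairing (dualModel E F) (L.jacobiBivec φ) f g p := rfl

/-- In the cyclic sum the double brackets cancel by the Jacobi identity, and the anchor derivatives
of `φ` cancel against `φ` of brackets by the cocycle condition. The products of `φ` with a single
bracket give `2 E ∧ Λ`; the terms quadratic in `φ` cancel on each side. -/
theorem schoutenBivec_jacobiBivec_linear_linear_linear (hφ : L.IsCocycle φ)
    (μ η ν : GlobalSections E F A) (p : DualBundle F A) :
    schoutenBivec (dualModel E F) (L.jacobiBivec φ) (L.jacobiBivec φ) (linearFunction μ)
        (linearFunction η) (linearFunction ν) p =
      2 * wedgeVecBivec (dualModel E F) (-verticalLift φ p) (L.jacobiBivec φ p)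
        (mvfderiv (dualModel E F) (linearFunction μ) p)
        (mvfderiv (dualModel E F) (linearFunction η) p)
        (mvfderiv (dualModel E F) (linearFunction ν) p) := by
  have hl := fun (μ : GlobalSections E F A) p => mdifferentiableAt_linearFunction μ p
  have hb := fun (f : C^∞⟮𝓘(ℝ, E), M; ℝ⟯) (p : DualBundle F A) =>
    mdifferentiableAt_basicFunction f.contMDiff p
  have el := fun μ => congrFun (along_neg_verticalLift_linear φ μ) p
  have ell := fun μ η => congrFun (L.jacobiBivec_linear_linear φ μ η) p
  have ebl := fun μ η => congrFun (L.jacobiBivec_basic_linear φ μ η) p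
  have iter : ∀ μ η ν : GlobalSections E F A, pairing (dualModel E F) (L.jacobiBivec φ)
      (pairing (dualModel E F) (L.jacobiBivec φ) (linearFunction μ) (linearFunction η))
      (linearFunction ν) p =
      pairing (dualModel E F) (L.jacobiBivec φ) (linearFunction (L.bracket μ η))
        (linearFunction ν) p +
      (linearFunction μ p * pairing (dualModel E F) (L.jacobiBivec φ)
          (basicFunction F A (dualApply φ η)) (linearFunction ν) p +
        basicFunction F A (dualApply φ η) p * pairing (dualModel E F) (L.jacobiBivec φ)
          (linearFunction μ) (linearFunction ν) p) -
      (basicFunction F A (dualApply φ μ) p * pairing (dualModel E F) (L.jacobiBivec φ)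
          (linearFunction η) (linearFunction ν) p +
        linearFunction η p * pairing (dualModel E F) (L.jacobiBivec φ)
          (basicFunction F A (dualApply φ μ)) (linearFunction ν) p) := by
    intro μ η ν
    rw [jacobiBivec_linear_linear,
      pairing_sub_left ((hl _ p).add ((hl _ p).mul (hb _ p))) ((hb _ p).mul (hl _ p)),
      pairing_add_left (hl _ p) ((hl _ p).mul (hb _ p)), pairing_mul_left (hl _ p) (hb _ p),
      pairing_mul_left (hb _ p) (hl _ p)]
  have hswap : ∀ μ η : GlobalSections E F A,
      linearFunction (L.bracket μ η) p = -linearFunction (L.bracket η μ) p := by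
    intro μ η
    rw [L.bracket_swap, linearFunction, linearFunction, ContMDiffSection.coe_neg, Pi.neg_apply,
      map_neg]
  have hjac : linearFunction (L.bracket (L.bracket μ η) ν) p +
      linearFunction (L.bracket (L.bracket η ν) μ) p +
      linearFunction (L.bracket (L.bracket ν μ) η) p = 0 := by
    have h := congrArg (fun s => linearFunction s p) (L.jacobi μ η ν)
    simp only [linearFunction_add, Pi.add_apply] at h
    rw [hswap _ ν, hswap _ μ, hswap _ η]
    have h0 : linearFunction (0 : GlobalSections E F A) p = 0 := map_zero p.2
    rw [h0] at h
    linarith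
  have hc := fun μ η => hφ.apply_bracket μ η p.1
  -- One orientation is fixed for the bracket of each pair, so that the final identity is polynomial
  -- in independent quantities.
  have s1 := hswap ν μ
  have s2 := hswap ν η
  have s3 := hswap η μ
  simp only [schoutenBivec, Pi.add_apply, wedgeVecBivec_neg_verticalLift]
  rw [iter μ η ν, iter η ν μ, iter ν μ η]
  simp only [ell, ebl, el, Pi.neg_apply, Pi.add_apply, Pi.sub_apply, Pi.mul_apply, basicFunction,
    hc]
  simp only [s1, s2, s3]
  linear_combination 2 * hjac

/-- Here the content is that the anchor preserves brackets: `ρ[[μ, η]] = [ρ(μ), ρ(η)]` applied to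
`f`. -/
theorem schoutenBivec_jacobiBivec_linear_linear_basic (μ η : GlobalSections E F A)
    (f : C^∞⟮𝓘(ℝ, E), M; ℝ⟯) (p : DualBundle F A) :
    schoutenBivec (dualModel E F) (L.jacobiBivec φ) (L.jacobiBivec φ) (linearFunction μ)
        (linearFunction η) (basicFunction F A f) p =
      2 * wedgeVecBivec (dualModel E F) (-verticalLift φ p) (L.jacobiBivec φ p)
        (mvfderiv (dualModel E F) (linearFunction μ) p)
        (mvfderiv (dualModel E F) (linearFunction η) p)
        (mvfderiv (dualModel E F) (basicFunction F A f) p) := by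
  have hl := fun (μ : GlobalSections E F A) p => mdifferentiableAt_linearFunction μ p
  have hb := fun (f : C^∞⟮𝓘(ℝ, E), M; ℝ⟯) (p : DualBundle F A) =>
    mdifferentiableAt_basicFunction f.contMDiff p
  have h : L.anchorApply (L.bracket μ η) f p.1 = L.anchorApply μ (L.anchorApply η f) p.1 -
      L.anchorApply η (L.anchorApply μ f) p.1 := L.anchorDeriv_bracket μ η f.contMDiff p.1
  simp only [schoutenBivec, Pi.add_apply, wedgeVecBivec_neg_verticalLift]
  rw [jacobiBivec_linear_linear,
    pairing_sub_left ((hl _ p).add ((hl _ p).mul (hb _ p))) ((hb _ p).mul (hl _ p)),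
    pairing_add_left (hl _ p) ((hl _ p).mul (hb _ p)), pairing_mul_left (hl _ p) (hb _ p),
    pairing_mul_left (hb _ p) (hl _ p)]
  simp only [along_neg_verticalLift_basic, along_neg_verticalLift_linear,
    jacobiBivec_linear_basic, jacobiBivec_basic_linear, jacobiBivec_basic_basic, pairing_neg_left,
    Pi.neg_apply, Pi.zero_apply, basicFunction]
  linear_combination 2 * h

theorem schoutenBivec_jacobiBivec_linear_basic_basic (μ : GlobalSections E F A)
    (f g : C^∞⟮𝓘(ℝ, E), M; ℝ⟯) (p : DualBundle F A) :
    schoutenBivec (dualModel E F) (L.jacobiBivec φ) (L.jacobiBivec φ) (linearFunction μ)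
        (basicFunction F A f) (basicFunction F A g) p =
      2 * wedgeVecBivec (dualModel E F) (-verticalLift φ p) (L.jacobiBivec φ p)
        (mvfderiv (dualModel E F) (linearFunction μ) p)
        (mvfderiv (dualModel E F) (basicFunction F A f) p)
        (mvfderiv (dualModel E F) (basicFunction F A g) p) := by
  simp only [schoutenBivec, Pi.add_apply, wedgeVecBivec_neg_verticalLift,
    jacobiBivec_linear_basic, jacobiBivec_basic_linear, jacobiBivec_basic_basic,
    pairing_neg_left, pairing_zero_left, along_neg_verticalLift_basic, Pi.zero_apply]
  ring

theorem schoutenBivec_jacobiBivec_basic_basic_basic (f g h : C^∞⟮𝓘(ℝ, E), M; ℝ⟯)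
    (p : DualBundle F A) :
    schoutenBivec (dualModel E F) (L.jacobiBivec φ) (L.jacobiBivec φ) (basicFunction F A f)
        (basicFunction F A g) (basicFunction F A h) p =
      2 * wedgeVecBivec (dualModel E F) (-verticalLift φ p) (L.jacobiBivec φ p)
        (mvfderiv (dualModel E F) (basicFunction F A f) p)
        (mvfderiv (dualModel E F) (basicFunction F A g) p)
        (mvfderiv (dualModel E F) (basicFunction F A h) p) := by
  simp only [schoutenBivec, Pi.add_apply, wedgeVecBivec_neg_verticalLift, jacobiBivec_basic_basic,
    pairing_zero_left, along_neg_verticalLift_basic, Pi.zero_apply]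
  ring

theorem schoutenBivec_generators (hφ : L.IsCocycle φ) : ∀ f ∈ generatorFunctions E F A,
    ∀ g ∈ generatorFunctions E F A, ∀ h ∈ generatorFunctions E F A, ∀ p,
    schoutenBivec (dualModel E F) (L.jacobiBivec φ) (L.jacobiBivec φ) f g h p =
      2 * wedgeVecBivec (dualModel E F) (-verticalLift φ p) (L.jacobiBivec φ p)
        (mvfderiv (dualModel E F) f p) (mvfderiv (dualModel E F) g p)
        (mvfderiv (dualModel E F) h p) := by
  -- Cyclic rotation moves the linear arguments to the front, reducing the eight cases to four.
  rintro _ (⟨μ, rfl⟩ | ⟨f, rfl⟩) _ (⟨η, rfl⟩ | ⟨g, rfl⟩) _ (⟨ν, rfl⟩ | ⟨h, rfl⟩) p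
  · exact schoutenBivec_jacobiBivec_linear_linear_linear hφ μ η ν p
  · exact schoutenBivec_jacobiBivec_linear_linear_basic μ η h p
  · rw [schoutenBivec_cyclic, schoutenBivec_cyclic, wedgeVecBivec_cyclic, wedgeVecBivec_cyclic]
    exact schoutenBivec_jacobiBivec_linear_linear_basic ν μ g p
  · exact schoutenBivec_jacobiBivec_linear_basic_basic μ g h p
  · rw [schoutenBivec_cyclic, wedgeVecBivec_cyclic]
    exact schoutenBivec_jacobiBivec_linear_linear_basic η ν f p
  · rw [schoutenBivec_cyclic, wedgeVecBivec_cyclic]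
    exact schoutenBivec_jacobiBivec_linear_basic_basic η h f p
  · rw [schoutenBivec_cyclic, schoutenBivec_cyclic, wedgeVecBivec_cyclic, wedgeVecBivec_cyclic]
    exact schoutenBivec_jacobiBivec_linear_basic_basic ν f g p
  · exact schoutenBivec_jacobiBivec_basic_basic_basic f g h p

/-- The Jacobi structure `(Λ_{A*} + Δ ∧ φ^v, -φ^v)`. -/
def jacobiStructure (hφ : L.IsCocycle φ) : JacobiStructure (dualModel E F) (DualBundle F A) where
  bivec := L.jacobiBivec φ
  vec p := -verticalLift φ p
  bivec_self := L.jacobiBivec_self φ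
  bivec_smooth :=
    generatesCoordinates_generatorFunctions.contMDiff_bivec (L.contMDiff_pairing_generators φ)
  vec_smooth :=
    generatesCoordinates_generatorFunctions.contMDiff_vec (contMDiff_along_generators φ)
  schouten_self _ _ _ hf hg hh x := schoutenBivec_eq_of_generators (L.jacobiBivec_self φ)
    generatesCoordinates_generatorFunctions (L.contMDiff_pairing_generators φ) _
    (schoutenBivec_generators hφ) hf hg hh x
  schouten_vec _ _ hf hg x := schoutenVecBivec_eq_zero_of_generators (L.jacobiBivec_self φ)
    generatesCoordinates_generatorFunctions (L.contMDiff_pairing_generators φ)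
    (generatesCoordinates_generatorFunctions.contMDiff_vec (contMDiff_along_generators φ))
    (schoutenVecBivec_generators hφ) hf hg x

/-- The terms `μ̃ E(η̃) - η̃ E(μ̃)` cancel the contribution of `Δ ∧ φ^v`. On a linear and a basic
function, `-f E(μ̃)` supplies the summand `φ(μ) f`. -/
theorem isInducedBy_jacobiStructure (hφ : L.IsCocycle φ) :
    L.IsInducedBy φ (jacobiStructure hφ) where
  linear_linear μ η := by
    simp only [JacobiStructure.bracket, jacobiStructure, jacobiBivec_linear_linear,
      along_neg_verticalLift_linear]
    ring
  linear_basic μ f := by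
    simp only [JacobiStructure.bracket, jacobiStructure, jacobiBivec_linear_basic,
      along_neg_verticalLift_linear, along_neg_verticalLift_basic]
    funext p
    simp only [Pi.sub_apply, Pi.mul_apply, Pi.neg_apply, mul_zero, add_zero,
      mul_neg, sub_neg_eq_add, mul_comm (basicFunction F A f p)]
    rfl
  basic_basic f g := by
    simp only [JacobiStructure.bracket, jacobiStructure, jacobiBivec_basic_basic,
      along_neg_verticalLift_basic]
    ring

omit [FiniteDimensional ℝ E] [T2Space M] [FiniteDimensional ℝ F] in
-- Bracketing with the constant function `1` isolates the vector field: `{μ̃, 1} = -E(μ̃)`, while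
-- the prescribed value is `φ(μ)`.
theorem IsInducedBy.along_linear {J : JacobiStructure (dualModel E F) (DualBundle F A)}
    (hJ : L.IsInducedBy φ J) (μ : GlobalSections E F A) :
    along (dualModel E F) J.vec (linearFunction μ) = -basicFunction F A (dualApply φ μ) := by
  funext p
  have h := congrFun (hJ.linear_basic μ 1) p
  have h1 : basicFunction F A ((1 : C^∞⟮𝓘(ℝ, E), M; ℝ⟯) : M → ℝ) = fun _ => (1 : ℝ) := rfl
  have h2 : ((1 : C^∞⟮𝓘(ℝ, E), M; ℝ⟯) : M → ℝ) = fun _ => (1 : ℝ) := rfl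
  rw [JacobiStructure.bracket, h1, pairing_swap J.bivec_self, h2] at h
  simp only [Pi.add_apply, Pi.sub_apply, Pi.mul_apply, Pi.neg_apply, pairing_const_left,
    basicFunction, mvfderiv_const, along, zero_apply, one_mul] at h
  simp only [along, Pi.neg_apply, basicFunction]
  change _ = -(φ p.1 (μ p.1))
  linarith

omit [FiniteDimensional ℝ E] [T2Space M] [FiniteDimensional ℝ F] in
theorem IsInducedBy.along_basic {J : JacobiStructure (dualModel E F) (DualBundle F A)}
    (hJ : L.IsInducedBy φ J) (f : C^∞⟮𝓘(ℝ, E), M; ℝ⟯) :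
    along (dualModel E F) J.vec (basicFunction F A f) = 0 := by
  funext p
  have h := congrFun (hJ.basic_basic f 1) p
  have h1 : basicFunction F A ((1 : C^∞⟮𝓘(ℝ, E), M; ℝ⟯) : M → ℝ) = fun _ => (1 : ℝ) := rfl
  rw [JacobiStructure.bracket, h1, pairing_swap J.bivec_self] at h
  simp only [Pi.add_apply, Pi.sub_apply, Pi.mul_apply, Pi.neg_apply, pairing_const_left,
    mvfderiv_const, along, zero_apply, one_mul, Pi.zero_apply] at h
  simp only [along, Pi.zero_apply]
  linarith

/-- The Jacobi structure is determined by its bracket on linear and basic functions. -/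
theorem IsInducedBy.eq {J J' : JacobiStructure (dualModel E F) (DualBundle F A)}
    (hJ : L.IsInducedBy φ J) (hJ' : L.IsInducedBy φ J') : J' = J := by
  have hvec : ∀ f ∈ generatorFunctions E F A,
      along (dualModel E F) J'.vec f = along (dualModel E F) J.vec f := by
    rintro _ (⟨μ, rfl⟩ | ⟨f, rfl⟩)
    · rw [hJ.along_linear, hJ'.along_linear]
    · rw [hJ.along_basic, hJ'.along_basic]
  have hbr : ∀ f ∈ generatorFunctions E F A, ∀ g ∈ generatorFunctions E F A,
      pairing (dualModel E F) J'.bivec f g = pairing (dualModel E F) J.bivec f g := by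
    intro f hf g hg
    -- The vector fields already agree on generators, so equal brackets force equal values of the
    -- bivectors.
    have key : ∀ f ∈ generatorFunctions E F A, ∀ g ∈ generatorFunctions E F A,
        J'.bracket f g = J.bracket f g →
        pairing (dualModel E F) J'.bivec f g = pairing (dualModel E F) J.bivec f g := by
      intro f hf g hg h
      simpa only [JacobiStructure.bracket, hvec f hf, hvec g hg, sub_left_inj, add_left_inj] using h
    obtain ⟨μ, rfl⟩ | ⟨f, rfl⟩ := id hf <;> obtain ⟨η, rfl⟩ | ⟨g, rfl⟩ := id hg
    · exact key _ hf _ hg ((hJ'.linear_linear μ η).trans (hJ.linear_linear μ η).symm)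
    · exact key _ hf _ hg ((hJ'.linear_basic μ g).trans (hJ.linear_basic μ g).symm)
    -- The bracket is prescribed only with the linear function first; antisymmetry covers the
    -- opposite order.
    · rw [pairing_swap J.bivec_self, pairing_swap J'.bivec_self,
        key _ hg _ hf ((hJ'.linear_basic η f).trans (hJ.linear_basic η f).symm)]
    · exact key _ hf _ hg ((hJ'.basic_basic f g).trans (hJ.basic_basic f g).symm)
  refine JacobiStructure.ext (funext fun p => ?_) (funext fun p => ?_)
  · exact generatesCoordinates_generatorFunctions.bivec_ext fun f hf g hg =>
      congrFun (hbr f hf g hg) p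
  · exact generatesCoordinates_generatorFunctions.vec_ext fun f hf => congrFun (hvec f hf) p

end LieAlgebroid
end AlgebroidJacobi

end

theorem theorem1
    {E : Type*} [NormedAddCommGroup E] [NormedSpace ℝ E] [FiniteDimensional ℝ E]
    {M : Type*} [TopologicalSpace M] [ChartedSpace E M] [T2Space M] [IsManifold 𝓘(ℝ, E) ∞ M]
    {F : Type*} [NormedAddCommGroup F] [NormedSpace ℝ F] [FiniteDimensional ℝ F]
    {A : M → Type*} [∀ x, AddCommGroup (A x)] [∀ x, Module ℝ (A x)]
    [∀ x, TopologicalSpace (A x)] [TopologicalSpace (TotalSpace F A)] [FiberBundle F A]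
    [VectorBundle ℝ F A] [ContMDiffVectorBundle ∞ F A 𝓘(ℝ, E)]
    (L : LieAlgebroid E F A) (φ : DualSections E F A) (hφ : L.IsCocycle φ) :
    ∃ J : JacobiStructure (dualModel E F) (DualBundle F A),
      L.IsInducedBy φ J ∧
      (∀ J' : JacobiStructure (dualModel E F) (DualBundle F A), L.IsInducedBy φ J' → J' = J) ∧
      (∀ p, J.bivec p =
        L.linearPoisson p + wedgeVec (dualModel E F) (liouville p) (verticalLift φ p)) ∧
      (∀ p, J.vec p = -verticalLift φ p) :=
  ⟨LieAlgebroid.jacobiStructure hφ, LieAlgebroid.isInducedBy_jacobiStructure hφ,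
    fun _ hJ' => (LieAlgebroid.isInducedBy_jacobiStructure hφ).eq hJ', fun _ => rfl, fun _ => rfl⟩
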